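/- Let $\Phi=\{\mathbf b_1,\dots,\mathbf b_{|\Phi|}\}$ be a finite collection of nonzero vectors in a two-dimensional real vector space, generating a lattice $\Lambda=\mathbb Z\Phi$ of full rank that has a $\mathbb Z$-basis consisting of two members of $\Phi$. Fix such a basis $\{\mathbf b_1,\mathbf b_2\}$, write $\mathbf b_\ell=s_{1,\ell}\mathbf b_1+s_{2,\ell}\mathbf b_2$ with $s_{1,\ell},s_{2,\ell}\in\mathbb Z$, and set $$a=\sum_{\ell=1}^{|\Phi|}s_{1,\ell}^2,\qquad b=2\sum_{\ell=1}^{|\Phi|}s_{1,\ell}s_{2,\ell},\qquad c=\sum_{\ell=1}^{|\Phi|}s_{2,\ell}^2,\qquad d=b^2-4ac .$$ Let $$f_1(x_1,x_2)=\Big(\frac1{|\Phi|}\sum_{\ell=1}^{|\Phi|}\frac{(s_{1,\ell}x_1+s_{2,\ell}x_2)^2}{2}\Big)^{-1},$$ the reciprocal of the second order Taylor polynomial at the origin of $\psi(x_1,x_2)=1-\frac1{|\Phi|}\sum_{\ell}\cos(s_{1,\ell}x_1+s_{2,\ell}x_2)$. For $n\ge1$ and $j,k\in\mathbb Z$ let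 $\mathbf t_{j,k}=\big(\frac{2\pi j}{n},\frac{2\pi k}{n}\big)$, and let $$F_n(f_1)=\sum_{\mathbf t_{j,k}\in D_n}f_1(\mathbf t_{j,k}),$$ where $D_n$ is the union of the closed squares with centre $\mathbf t_{j,k}$ and side $\frac{2\pi}n$ over all $(j,k)\in\mathbb Z^2$ with $\mathbf t_{j,k}\in[-\pi,\pi)^2\setminus\{\mathbf 0\}$ (so that the sum runs over exactly the $(j,k)\in\mathbb Z^2$ with $\mathbf t_{j,k}\in[-\pi,\pi)^2\setminus\{\mathbf 0\}$). Then, as $n\to\infty$, $$\begin{aligned}F_n(f_1)={}&\frac{2|\Phi|}{\pi\sqrt{|d|}}\,n^2\log n\\&+\frac{|\Phi|}{\pi^2\sqrt{|d|}}\Big[2\pi(\gamma-\log2)-4\pi\log|\eta(\mu)|+\Big(\frac\pi2-\arctan\frac{c-a}{\sqrt{|d|}}\Big)\log\frac ca-C(a,b,c)\Big]n^2\\&+\frac{|\Phi|}{\pi^2}\Big[\frac13\Big(\frac1{a-b+c}+\frac1{a+b+c}+\frac{\pi}{\sqrt{|d|}}\Big)-\frac{1+(-1)^n}{2}\Big(\frac{\pi}{\sqrt{|d|}}+\frac{2}{a-b+c}\Big)\Big]+\mathcal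 O\Big(\frac{\log n}{n^2}\Big),\end{aligned}$$ where $\gamma$ is Euler's constant, $\eta$ is the Dedekind eta-function, $\mu=\frac{-b+\sqrt{|d|}\,i}{2c}$, and, with the Clausen function $\mathrm{Cl}_2(\theta)=\sum_{k\ge1}\frac{\sin k\theta}{k^2}$, $$C(a,b,c)=\sum_{z\in\{a,c\}}\ \sum_{\pm}\mathrm{Cl}_2\Big(\pi-2\arctan\frac{2z\pm b}{\sqrt{|d|}}\Big)$$ (four terms, also when $a=c$). -/

import Mathlib

namespace LatticeSum

noncomputable section

/-- The grid coordinate `t_j = 2πj/n`. -/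
def t (n : ℕ) (j : ℤ) : ℝ := 2 * Real.pi * j / n

/-- The grid point `t_{j,k} = (t_j, t_k)`. -/
def tt (n : ℕ) (p : ℤ × ℤ) : ℝ × ℝ := (t n p.1, t n p.2)

/-- The cell end point `x_j = t_j - π/n`. -/
def x (n : ℕ) (j : ℤ) : ℝ := t n j - Real.pi / n

/-- The cell `X_{j,k} = [x_j, x_{j+1}] × [x_k, x_{k+1}]`. -/
def cell (n : ℕ) (p : ℤ × ℤ) : Set (ℝ × ℝ) :=
  Set.Icc (x n p.1) (x n (p.1 + 1)) ×ˢ Set.Icc (x n p.2) (x n (p.2 + 1))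

/-- The domain `D_n`: the union of the cells `X_{j,k}` over the grid points
`t_{j,k}` in `[-π, π)² \ {0}`. -/
def D (n : ℕ) : Set (ℝ × ℝ) :=
  ⋃ p ∈ {p : ℤ × ℤ | tt n p ∈
    (Set.Ico (-Real.pi) Real.pi ×ˢ Set.Ico (-Real.pi) Real.pi) \ {(0 : ℝ × ℝ)}}, cell n p

/-- `F_n(g)`, the sum of `g(t_{j,k})` over all `(j,k) ∈ ℤ²` with `t_{j,k} ∈ D_n`
(a finite index set for every `n ≥ 1`). -/
def F (n : ℕ) (g : ℝ × ℝ → ℝ) : ℝ :=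
  ∑ᶠ p ∈ {p : ℤ × ℤ | tt n p ∈ D n}, g (tt n p)

section Phi

variable {V ι : Type*} [AddCommGroup V] [Module ℝ V] [Fintype ι]

/-- The coordinate `s_{k,ℓ}` of `v ℓ` in the basis `B`, that is, the pairing of `v ℓ` with the
`k`-th vector of the dual basis. The indices `k = 0, 1` stand for the first and second one. -/
def s (B : Module.Basis (Fin 2) ℝ V) (v : ι → V) (k : Fin 2) (ℓ : ι) : ℝ := B.coord k (v ℓ)

/-- The Taylor polynomial of order `2m` at the origin of
`ψ(y) = 1 - (1/|Φ|) ∑_ℓ cos (s_ℓ · y)`, where `Φ = (v ℓ)_ℓ`. -/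
def taylorPoly (B : Module.Basis (Fin 2) ℝ V) (v : ι → V) (m : ℕ) (y : ℝ × ℝ) : ℝ :=
  1 / (Fintype.card ι : ℝ) * ∑ ℓ, ∑ j ∈ Finset.Icc 1 m,
    (-1 : ℝ) ^ (j + 1) * (s B v 0 ℓ * y.1 + s B v 1 ℓ * y.2) ^ (2 * j) / (Nat.factorial (2 * j) : ℝ)

/-- `f_m = 1 / p_m`. -/
def f (B : Module.Basis (Fin 2) ℝ V) (v : ι → V) (m : ℕ) (y : ℝ × ℝ) : ℝ :=
  1 / taylorPoly B v m y

/-- `a = ∑ s_{1,ℓ}²`. -/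
def coeffA (B : Module.Basis (Fin 2) ℝ V) (v : ι → V) : ℝ := ∑ ℓ, s B v 0 ℓ ^ 2

/-- `b = 2 ∑ s_{1,ℓ} s_{2,ℓ}`. -/
def coeffB (B : Module.Basis (Fin 2) ℝ V) (v : ι → V) : ℝ := 2 * ∑ ℓ, s B v 0 ℓ * s B v 1 ℓ

/-- `c = ∑ s_{2,ℓ}²`. -/
def coeffC (B : Module.Basis (Fin 2) ℝ V) (v : ι → V) : ℝ := ∑ ℓ, s B v 1 ℓ ^ 2

end Phi

/-- The discriminant `d = b² - 4ac`. -/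
def disc (a b c : ℝ) : ℝ := b ^ 2 - 4 * a * c

/-- `μ = (-b + √|d| i) / (2c)`. -/
def mu (a b c : ℝ) : ℂ :=
  (-(b : ℂ) + (Real.sqrt |disc a b c| : ℂ) * Complex.I) / (2 * (c : ℂ))

/-- The Clausen function `Cl₂(θ) = ∑_{k ≥ 1} sin(kθ)/k²`. -/
def clausen (θ : ℝ) : ℝ := ∑' k : ℕ, Real.sin ((k + 1 : ℝ) * θ) / (k + 1 : ℝ) ^ 2

/-- The constant `C(a,b,c)`. -/
def constC (a b c : ℝ) : ℝ :=
  clausen (Real.pi - 2 * Real.arctan ((2 * a - b) / Real.sqrt |disc a b c|))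
  + clausen (Real.pi - 2 * Real.arctan ((2 * a + b) / Real.sqrt |disc a b c|))
  + clausen (Real.pi - 2 * Real.arctan ((2 * c - b) / Real.sqrt |disc a b c|))
  + clausen (Real.pi - 2 * Real.arctan ((2 * c + b) / Real.sqrt |disc a b c|))

end

end LatticeSum

/-! Write `δ = √|d|`. By homogeneity the sum is `N n² / (2π²)` times the sum of `1 / (a j² + b j k +
c k²)` over a square of lattice points without the origin: `|j|, |k| ≤ M` when `n = 2M + 1`, and `-M
≤ j, k < M` when `n = 2M`. So sums over squares have to be expanded up to `O(M⁻⁴)`. This needs the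
constant term and, separately, the lower order terms.

The constant comes from Kronecker's limit formula (`exists_row_sums`). The form equals `c |j μ -
k|²`, so a complete row `j ≠ 0` is the imaginary part of a cotangent. The leading parts of the rows
form a harmonic sum, giving `log M` and Euler's constant; the exponentially small parts form a
Lambert series, giving the product in `η(μ)`. Passing from rows to the square removes the strips
`|j| ≤ M < |k|`. By `exists_tail_bound` each strip tends to the integral over `(0, 1]` of `(G(w) -
G(-w)) / w`, with `G` an antiderivative of `1 / (c + b u + a u²)`. Integration by parts turns this
into an integral of `log |u|` against that kernel, which Clausen's function evaluates because `log
|u|` splits into logarithms of a sine and a cosine of the angle `arctan ((2 a u + b) / δ)`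
(`logKernInt_one_sub`).

The lower order terms come from the increments. The boundary of `[-m, m]²` is summed by
Euler–Maclaurin to accuracy `O(m⁻⁵)` (`exists_shell_bound`), and an ansatz in `M + 1/2` matches
these increments to the same accuracy. The difference between sum and ansatz is then a null sequence
with increments `O(m⁻⁵)`, hence `O(M⁻⁴)` (`exists_boxSum_bound`). The half-open square differs from
the closed one by half a shell and one corner, which produces the parity-dependent term. -/

namespace LatticeSum

open Filter Topology

/-! ### The Clausen function and its derivative, by Abel summation. -/

section Clausen

lemma summable_one_div_succ_sq : Summable fun k : ℕ => 1 / ((k : ℝ) + 1) ^ 2 := by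
  have := (summable_nat_add_iff 1).mpr (Real.summable_one_div_nat_pow.mpr one_lt_two)
  simpa using this

lemma norm_clausen_term_le (θ : ℝ) (k : ℕ) :
    ‖Real.sin ((k + 1 : ℝ) * θ) / (k + 1 : ℝ) ^ 2‖ ≤ 1 / ((k : ℝ) + 1) ^ 2 := by
  rw [norm_div, Real.norm_of_nonneg (by positivity : (0 : ℝ) ≤ (k + 1 : ℝ) ^ 2)]
  gcongr
  exact Real.abs_sin_le_one _

lemma continuous_clausen : Continuous clausen :=
  continuous_tsum (fun k => by fun_prop) summable_one_div_succ_sq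
    fun k θ => norm_clausen_term_le θ k

lemma clausen_neg (θ : ℝ) : clausen (-θ) = -clausen θ := by
  simp only [clausen, mul_neg, Real.sin_neg, neg_div, tsum_neg]

lemma clausen_add_two_pi (θ : ℝ) : clausen (θ + 2 * Real.pi) = clausen θ := by
  unfold clausen
  refine tsum_congr fun k => ?_
  have : (k + 1 : ℝ) * (θ + 2 * Real.pi) = (k + 1 : ℝ) * θ + (k + 1 : ℕ) * (2 * Real.pi) := by
    push_cast; ring
  rw [this, Real.sin_add_nat_mul_two_pi]

/-- The real part of the logarithm series on the circle of radius `r`. -/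
lemma hasSum_pow_mul_cos_div {r : ℝ} (h0 : 0 ≤ r) (h1 : r < 1) (θ : ℝ) :
    HasSum (fun k : ℕ => r ^ (k + 1) * (Real.cos ((k + 1 : ℝ) * θ) / (k + 1 : ℝ)))
      (-(Real.log (1 - 2 * r * Real.cos θ + r ^ 2) / 2)) := by
  have hz : ‖(r : ℂ) * Complex.exp (θ * Complex.I)‖ < 1 := by
    rw [norm_mul, Complex.norm_exp_ofReal_mul_I, mul_one, Complex.norm_real,
      Real.norm_of_nonneg h0]
    exact h1
  have h := Complex.hasSum_re (Complex.hasSum_taylorSeries_neg_log' hz)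
  convert h using 1
  · ext k
    have : ((r : ℂ) * Complex.exp (θ * Complex.I)) ^ (k + 1) / ((k : ℂ) + 1) =
        ((r ^ (k + 1) / (k + 1) : ℝ) : ℂ) * Complex.exp (((k + 1 : ℝ) * θ : ℝ) * Complex.I) := by
      rw [mul_pow, ← Complex.exp_nat_mul]
      push_cast
      rw [show ((k : ℂ) + 1) * (θ * Complex.I) = ((k : ℂ) + 1) * θ * Complex.I by ring]
      ring
    rw [this, Complex.re_ofReal_mul, Complex.exp_ofReal_mul_I_re]
    ring
  · rw [Complex.neg_re, Complex.log_re, neg_inj]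
    have hsq : 1 - 2 * r * Real.cos θ + r ^ 2 = ‖1 - (r : ℂ) * Complex.exp (θ * Complex.I)‖ ^ 2 := by
      rw [Complex.sq_norm, Complex.normSq_apply]
      simp only [Complex.sub_re, Complex.one_re, Complex.re_ofReal_mul, Complex.exp_ofReal_mul_I_re,
        Complex.sub_im, Complex.one_im, Complex.im_ofReal_mul, Complex.exp_ofReal_mul_I_im]
      nlinarith [Real.sin_sq_add_cos_sq θ]
    rw [hsq, Real.log_pow]
    push_cast
    ring

/-- For `r < 1` the geometric majorant `r ^ (k + 1)` permits termwise differentiation, which is not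
available on the unit circle itself. -/
lemma hasDerivAt_abel_clausen {r : ℝ} (h0 : 0 ≤ r) (h1 : r < 1) (θ : ℝ) :
    HasDerivAt (fun θ => ∑' k : ℕ, r ^ (k + 1) * (Real.sin ((k + 1 : ℝ) * θ) / (k + 1 : ℝ) ^ 2))
      (-(Real.log (1 - 2 * r * Real.cos θ + r ^ 2) / 2)) θ := by
  rw [← (hasSum_pow_mul_cos_div h0 h1 θ).tsum_eq]
  have hs : Summable fun k : ℕ => r ^ (k + 1) :=
    (summable_nat_add_iff 1).mpr (summable_geometric_of_lt_one h0 h1)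
  refine hasDerivAt_tsum (𝕜 := ℝ) (u := fun k : ℕ => r ^ (k + 1))
    (g := fun (k : ℕ) (θ : ℝ) => r ^ (k + 1) * (Real.sin ((k + 1 : ℝ) * θ) / (k + 1 : ℝ) ^ 2))
    (g' := fun (k : ℕ) (θ : ℝ) => r ^ (k + 1) * (Real.cos ((k + 1 : ℝ) * θ) / (k + 1 : ℝ)))
    hs ?_ ?_ (y₀ := 0) ?_ θ
  · intro k y
    have hk : (k + 1 : ℝ) ≠ 0 := by positivity
    have h := (((hasDerivAt_id y).const_mul (k + 1 : ℝ)).sin.div_const ((k + 1 : ℝ) ^ 2)).const_mul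
      (r ^ (k + 1))
    simp only [id_eq, mul_one] at h
    convert! h using 1
    field_simp
  · intro k y
    rw [norm_mul, Real.norm_of_nonneg (pow_nonneg h0 _), norm_div,
      Real.norm_of_nonneg (by positivity : (0 : ℝ) ≤ k + 1)]
    refine mul_le_of_le_one_right (pow_nonneg h0 _) ?_
    rw [div_le_one (by positivity)]
    have := Real.abs_cos_le_one ((k + 1 : ℝ) * y)
    rw [Real.norm_eq_abs]
    linarith [(Nat.cast_nonneg k : (0 : ℝ) ≤ k)]
  · simp [summable_zero]

lemma tendsto_abel_clausen (θ : ℝ) :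
    Tendsto (fun r : ℝ => ∑' k : ℕ, r ^ (k + 1) * (Real.sin ((k + 1 : ℝ) * θ) / (k + 1 : ℝ) ^ 2))
      (𝓝[<] 1) (𝓝 (clausen θ)) := by
  refine tendsto_tsum_of_dominated_convergence summable_one_div_succ_sq (fun k => ?_) ?_
  · have : Tendsto (fun r : ℝ => r ^ (k + 1) * (Real.sin ((k + 1 : ℝ) * θ) / (k + 1 : ℝ) ^ 2))
        (𝓝 1) (𝓝 (1 ^ (k + 1) * (Real.sin ((k + 1 : ℝ) * θ) / (k + 1 : ℝ) ^ 2))) :=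
      Continuous.tendsto (by fun_prop) 1
    rw [one_pow, one_mul] at this
    exact this.mono_left nhdsWithin_le_nhds
  · have h : ∀ᶠ r : ℝ in 𝓝[<] 1, r ∈ Set.Ioo 0 1 := Ioo_mem_nhdsLT one_pos
    filter_upwards [h] with r hr k
    rw [norm_mul, Real.norm_of_nonneg (pow_nonneg hr.1.le _)]
    exact (mul_le_of_le_one_left (norm_nonneg _) (pow_le_one₀ hr.1.le hr.2.le)).trans
      (norm_clausen_term_le θ k)

/-- The termwise derivative `∑ cos (kθ) / k` is not absolutely convergent, so the derivative is
taken for the Abel means and `r → 1` afterwards: their derivatives have a closed form jointly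
continuous at `(1, θ)`, hence converge uniformly near `θ`. As `Real.log` is `log |·|`, no sign
condition on the sine is needed. -/
lemma hasDerivAt_clausen {θ : ℝ} (h : Real.sin (θ / 2) ≠ 0) :
    HasDerivAt clausen (-Real.log (2 * Real.sin (θ / 2))) θ := by
  have hsin : 1 - 2 * 1 * Real.cos θ + 1 ^ 2 = (2 * Real.sin (θ / 2)) ^ 2 := by
    have : Real.cos θ = Real.cos (2 * (θ / 2)) := by ring_nf
    rw [this, Real.cos_two_mul]
    nlinarith [Real.sin_sq_add_cos_sq (θ / 2)]
  have hpos : 1 - 2 * 1 * Real.cos θ + 1 ^ 2 ≠ 0 := by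
    rw [hsin]
    exact pow_ne_zero _ (mul_ne_zero two_ne_zero h)
  have hval : -Real.log (2 * Real.sin (θ / 2)) =
      (fun θ => -(Real.log (1 - 2 * 1 * Real.cos θ + 1 ^ 2) / 2)) θ := by
    simp only [hsin, Real.log_pow]
    push_cast
    ring
  rw [hval]
  have hcont : ContinuousAt (fun q : ℝ × ℝ => -(Real.log (1 - 2 * q.1 * Real.cos q.2 + q.1 ^ 2) / 2))
      (1, θ) := by
    have h1 : ContinuousAt (fun q : ℝ × ℝ => 1 - 2 * q.1 * Real.cos q.2 + q.1 ^ 2) (1, θ) :=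
      Continuous.continuousAt (by fun_prop)
    exact ((h1.log hpos).div_const 2).neg
  have hcont2 : ContinuousAt (fun y : ℝ => -(Real.log (1 - 2 * 1 * Real.cos y + 1 ^ 2) / 2)) θ := by
    have h1 : ContinuousAt (fun y : ℝ => 1 - 2 * 1 * Real.cos y + 1 ^ 2) θ :=
      Continuous.continuousAt (by fun_prop)
    exact ((h1.log hpos).div_const 2).neg
  refine hasDerivAt_of_tendstoUniformlyOnFilter (l := 𝓝[<] (1 : ℝ))
    (f := fun r θ => ∑' k : ℕ, r ^ (k + 1) * (Real.sin ((k + 1 : ℝ) * θ) / (k + 1 : ℝ) ^ 2))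
    (f' := fun r y => -(Real.log (1 - 2 * r * Real.cos y + r ^ 2) / 2))
    (g' := fun θ => -(Real.log (1 - 2 * 1 * Real.cos θ + 1 ^ 2) / 2)) ?_ ?_
    (Eventually.of_forall fun y => tendsto_abel_clausen y)
  · rw [Metric.tendstoUniformlyOnFilter_iff]
    intro ε hε
    have h1 : Tendsto (fun q : ℝ × ℝ => -(Real.log (1 - 2 * q.1 * Real.cos q.2 + q.1 ^ 2) / 2))
        (𝓝[<] 1 ×ˢ 𝓝 θ) (𝓝 (-(Real.log (1 - 2 * 1 * Real.cos θ + 1 ^ 2) / 2))) := by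
      refine hcont.tendsto.mono_left ?_
      rw [nhds_prod_eq]
      exact Filter.prod_mono nhdsWithin_le_nhds le_rfl
    have h2 : Tendsto (fun q : ℝ × ℝ => -(Real.log (1 - 2 * 1 * Real.cos q.2 + 1 ^ 2) / 2))
        (𝓝[<] (1 : ℝ) ×ˢ 𝓝 θ) (𝓝 (-(Real.log (1 - 2 * 1 * Real.cos θ + 1 ^ 2) / 2))) :=
      hcont2.tendsto.comp tendsto_snd
    have h3 := h2.dist h1
    rw [dist_self] at h3
    exact h3.eventually (gt_mem_nhds hε)
  · have h : ∀ᶠ r : ℝ in 𝓝[<] 1, r ∈ Set.Ioo 0 1 := Ioo_mem_nhdsLT one_pos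
    filter_upwards [h.prod_inl (𝓝 θ)] with q hq
    exact hasDerivAt_abel_clausen hq.1.le hq.2 q.2

end Clausen

/-! ### Trapezoidal rule with derivative correction, and plain Riemann sums. -/

section EulerMaclaurin

/-- If `f` vanishes at `0` and `|f'| ≤ K s ^ p`, then `|f| ≤ K s ^ (p + 1)`. -/
lemma abs_le_mul_pow_succ_of_deriv {g g' : ℝ → ℝ} {K L : ℝ} {p : ℕ} (hK : 0 ≤ K)
    (hg : ∀ s ∈ Set.Icc 0 L, HasDerivAt g (g' s) s) (h0 : g 0 = 0)
    (hb : ∀ s ∈ Set.Icc 0 L, |g' s| ≤ K * s ^ p) :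
    ∀ s ∈ Set.Icc 0 L, |g s| ≤ K * s ^ (p + 1) := by
  intro s hs
  have h := (convex_Icc (0 : ℝ) s).norm_image_sub_le_of_norm_hasDerivWithin_le
    (f := g) (f' := g') (C := K * s ^ p) (fun u hu => (hg u ⟨hu.1, hu.2.trans hs.2⟩).hasDerivWithinAt)
    (fun u hu => (hb u ⟨hu.1, hu.2.trans hs.2⟩).trans
      (mul_le_mul_of_nonneg_left (pow_le_pow_left₀ hu.1 hu.2 p) hK))
    (Set.left_mem_Icc.2 hs.1) (Set.right_mem_Icc.2 hs.1)
  simp only [h0, sub_zero, Real.norm_eq_abs, abs_of_nonneg hs.1] at h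
  rw [pow_succ, ← mul_assoc]
  exact h

/-- The corrected trapezoidal rule on one cell. -/
lemma trapezoid_cell {H h h₁ h₂ h₃ h₄ : ℝ → ℝ} {K : ℝ}
    (dH : ∀ u, HasDerivAt H (h u) u) (dh : ∀ u, HasDerivAt h (h₁ u) u)
    (dh₁ : ∀ u, HasDerivAt h₁ (h₂ u) u) (dh₂ : ∀ u, HasDerivAt h₂ (h₃ u) u)
    (dh₃ : ∀ u, HasDerivAt h₃ (h₄ u) u) (hK : ∀ u ∈ Set.Icc (-1 : ℝ) 1, |h₄ u| ≤ K)
    {x s : ℝ} (hx : -1 ≤ x) (hs : 0 ≤ s) (hxs : x + s ≤ 1) :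
    |H (x + s) - H x - s / 2 * (h x + h (x + s)) + s ^ 2 / 12 * (h₁ (x + s) - h₁ x)|
      ≤ K * s ^ 5 := by
  have hK0 : 0 ≤ K := (abs_nonneg _).trans (hK 0 (by norm_num))
  have shift : ∀ {φ φ' : ℝ → ℝ}, (∀ u, HasDerivAt φ (φ' u) u) →
      ∀ u, HasDerivAt (fun s => φ (x + s)) (φ' (x + u)) u := fun hφ u =>
    (hφ (x + u)).comp_const_add x u
  -- The error as a function of the cell width. It and its derivatives `e₁`, `e₂` vanish at `0`, and
  -- `e₂' = s² h₄ / 12`; integrating the bound `K s²` three times gives `K s⁵`.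
  let e₀ : ℝ → ℝ := fun s =>
    H (x + s) - H x - s / 2 * (h x + h (x + s)) + s ^ 2 / 12 * (h₁ (x + s) - h₁ x)
  let e₁ : ℝ → ℝ := fun s => (h (x + s) - h x) / 2 - s / 2 * h₁ (x + s)
    + s / 6 * (h₁ (x + s) - h₁ x) + s ^ 2 / 12 * h₂ (x + s)
  let e₂ : ℝ → ℝ := fun s => (h₁ (x + s) - h₁ x) / 6 - s / 6 * h₂ (x + s) + s ^ 2 / 12 * h₃ (x + s)
  have d0 : ∀ u, HasDerivAt e₀ (e₁ u) u := fun u => by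
    have hid := hasDerivAt_id u
    convert! (((shift dH u).sub_const (H x)).sub ((hid.div_const 2).mul
      ((shift dh u).const_add (h x)))).add (((hid.pow 2).div_const 12).mul
        ((shift dh₁ u).sub_const (h₁ x))) using 1
    simp only [e₁, id_eq, Pi.pow_apply]
    push_cast
    ring
  have d1 : ∀ u, HasDerivAt e₁ (e₂ u) u := fun u => by
    have hid := hasDerivAt_id u
    convert! (((((shift dh u).sub_const (h x)).div_const 2).sub ((hid.div_const 2).mul
      (shift dh₁ u))).add ((hid.div_const 6).mul ((shift dh₁ u).sub_const (h₁ x)))).add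
        (((hid.pow 2).div_const 12).mul (shift dh₂ u)) using 1
    simp only [e₂, id_eq, Pi.pow_apply]
    push_cast
    ring
  have d2 : ∀ u, HasDerivAt e₂ (u ^ 2 / 12 * h₄ (x + u)) u := fun u => by
    have hid := hasDerivAt_id u
    convert! ((((shift dh₁ u).sub_const (h₁ x)).div_const 6).sub ((hid.div_const 6).mul
      (shift dh₂ u))).add (((hid.pow 2).div_const 12).mul (shift dh₃ u)) using 1
    simp only [id_eq, Pi.pow_apply]
    push_cast
    ring
  have b2 := abs_le_mul_pow_succ_of_deriv (L := s) (p := 2) hK0 (fun u _ => d2 u) (by simp [e₂]) (by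
    intro u hu
    have h4 := hK (x + u) ⟨by linarith [hu.1], by linarith [hu.2]⟩
    rw [abs_mul, abs_of_nonneg (by positivity : 0 ≤ u ^ 2 / 12), mul_comm]
    refine mul_le_mul h4 ?_ (by positivity) hK0
    linarith [sq_nonneg u])
  have b1 := abs_le_mul_pow_succ_of_deriv (L := s) hK0 (fun u _ => d1 u) (by simp [e₁]) b2
  exact abs_le_mul_pow_succ_of_deriv (L := s) hK0 (fun u _ => d0 u) (by simp [e₀]) b1 s ⟨hs, le_rfl⟩

lemma sum_Icc_neg_eq_sum_range (m : ℕ) (g : ℤ → ℝ) :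
    ∑ k ∈ Finset.Icc (-(m : ℤ)) m, g k = ∑ i ∈ Finset.range (2 * m + 1), g ((i : ℤ) - m) := by
  symm
  refine Finset.sum_bij (fun (i : ℕ) _ => (i : ℤ) - m) ?_ ?_ ?_ (fun _ _ => rfl)
  · intro i hi
    simp only [Finset.mem_range, Finset.mem_Icc] at hi ⊢
    omega
  · intro i _ j _ h
    simpa using h
  · intro k hk
    simp only [Finset.mem_Icc] at hk
    exact ⟨(k + m).toNat, by simp only [Finset.mem_range]; omega, by omega⟩

/-- The corrected trapezoidal rule on `[-1, 1]` with step `1 / m`. -/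
lemma trapezoid_sum {H h h₁ h₂ h₃ h₄ : ℝ → ℝ} {K : ℝ}
    (dH : ∀ u, HasDerivAt H (h u) u) (dh : ∀ u, HasDerivAt h (h₁ u) u)
    (dh₁ : ∀ u, HasDerivAt h₁ (h₂ u) u) (dh₂ : ∀ u, HasDerivAt h₂ (h₃ u) u)
    (dh₃ : ∀ u, HasDerivAt h₃ (h₄ u) u) (hK : ∀ u ∈ Set.Icc (-1 : ℝ) 1, |h₄ u| ≤ K)
    {m : ℕ} (hm : 1 ≤ m) :
    |1 / (m : ℝ) * (∑ k ∈ Finset.Icc (-(m : ℤ)) m, h ((k : ℝ) / m) - (h (-1) + h 1) / 2)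
      - (H 1 - H (-1)) - 1 / (12 * (m : ℝ) ^ 2) * (h₁ 1 - h₁ (-1))| ≤ 2 * K / (m : ℝ) ^ 4 := by
  have hm0 : (0 : ℝ) < m := by exact_mod_cast hm
  set y : ℕ → ℝ := fun i => -1 + i / m with hy
  have y0 : y 0 = -1 := by simp [hy]
  have y2 : y (2 * m) = 1 := by simp only [hy]; push_cast; field_simp; ring
  have ysucc : ∀ i, y i + 1 / m = y (i + 1) := fun i => by simp only [hy]; push_cast; ring
  have hsum : ∑ k ∈ Finset.Icc (-(m : ℤ)) m, h ((k : ℝ) / m)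
      = ∑ i ∈ Finset.range (2 * m + 1), h (y i) := by
    rw [sum_Icc_neg_eq_sum_range m fun k => h ((k : ℝ) / m)]
    refine Finset.sum_congr rfl fun i _ => ?_
    congr 1
    simp only [hy]
    push_cast
    field_simp
    ring
  have htrap : ∑ i ∈ Finset.range (2 * m + 1), h (y i) - (h (-1) + h 1) / 2
      = ∑ i ∈ Finset.range (2 * m), (h (y i) + h (y (i + 1))) / 2 := by
    rw [← Finset.sum_div, Finset.sum_add_distrib]
    have e1 := Finset.sum_range_succ (fun i => h (y i)) (2 * m)
    have e2 := Finset.sum_range_succ' (fun i => h (y i)) (2 * m)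
    simp only [y0, y2] at e1 e2
    linarith
  have tH := Finset.sum_range_sub (fun i => H (y i)) (2 * m)
  have th := Finset.sum_range_sub (fun i => h₁ (y i)) (2 * m)
  rw [y0, y2] at tH th
  have key : 1 / (m : ℝ) * (∑ k ∈ Finset.Icc (-(m : ℤ)) m, h ((k : ℝ) / m) - (h (-1) + h 1) / 2)
      - (H 1 - H (-1)) - 1 / (12 * (m : ℝ) ^ 2) * (h₁ 1 - h₁ (-1))
      = -∑ i ∈ Finset.range (2 * m), (H (y i + 1 / m) - H (y i)
        - (1 / m : ℝ) / 2 * (h (y i) + h (y i + 1 / m))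
        + (1 / m : ℝ) ^ 2 / 12 * (h₁ (y i + 1 / m) - h₁ (y i))) := by
    rw [hsum, htrap]
    simp only [ysucc]
    rw [Finset.sum_add_distrib, Finset.sum_sub_distrib, ← Finset.mul_sum, ← Finset.mul_sum, tH, th,
      ← Finset.sum_div]
    field_simp
    ring
  rw [key, abs_neg]
  refine (Finset.abs_sum_le_sum_abs _ _).trans ?_
  refine (Finset.sum_le_card_nsmul _ _ (K * (1 / m : ℝ) ^ 5) ?_).trans (le_of_eq ?_)
  · intro i hi
    have hi' : (i : ℝ) + 1 ≤ 2 * m := by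
      have := Finset.mem_range.1 hi
      exact_mod_cast this
    refine trapezoid_cell dH dh dh₁ dh₂ dh₃ hK ?_ (by positivity) ?_
    · simp only [hy]
      linarith [show (0 : ℝ) ≤ i / m by positivity]
    · rw [ysucc, hy]
      have : ((i + 1 : ℕ) : ℝ) / m ≤ 2 := by
        rw [div_le_iff₀ hm0]
        push_cast
        exact hi'
      simp only
      linarith
  · rw [Finset.card_range, nsmul_eq_mul]
    push_cast
    field_simp

/-- Riemann sums with step `1 / k` over `[-M / k, M / k]`, where `M ≤ k`. -/
lemma riemann_sum {H h h₁ : ℝ → ℝ} {K B : ℝ}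
    (dH : ∀ u, HasDerivAt H (h u) u) (dh : ∀ u, HasDerivAt h (h₁ u) u)
    (hK : ∀ u ∈ Set.Icc (-1 : ℝ) 1, |h₁ u| ≤ K) (hB : ∀ u ∈ Set.Icc (-1 : ℝ) 1, |h u| ≤ B)
    {M k : ℕ} (hk : 1 ≤ k) (hMk : M ≤ k) :
    |1 / (k : ℝ) * ∑ j ∈ Finset.Icc (-(M : ℤ)) M, h ((j : ℝ) / k)
      - (H (M / k) - H (-(M / k)))| ≤ (2 * K + B) / k := by
  have hk0 : (0 : ℝ) < k := by exact_mod_cast hk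
  have hK0 : 0 ≤ K := (abs_nonneg _).trans (hK 0 (by norm_num))
  have hMk' : (M : ℝ) ≤ k := by exact_mod_cast hMk
  have hw : (M : ℝ) / k ≤ 1 := by rwa [div_le_one hk0]
  have hw0 : (0 : ℝ) ≤ M / k := by positivity
  set y : ℕ → ℝ := fun i => -(M / k) + i / k with hy
  have y0 : y 0 = -(M / k) := by simp [hy]
  have y2 : y (2 * M) = M / k := by simp only [hy]; push_cast; field_simp; ring
  have ysucc : ∀ i, y i + 1 / k = y (i + 1) := fun i => by simp only [hy]; push_cast; ring
  have hsum : ∑ j ∈ Finset.Icc (-(M : ℤ)) M, h ((j : ℝ) / k)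
      = ∑ i ∈ Finset.range (2 * M + 1), h (y i) := by
    rw [sum_Icc_neg_eq_sum_range M fun j => h ((j : ℝ) / k)]
    refine Finset.sum_congr rfl fun i _ => ?_
    congr 1
    simp only [hy]
    push_cast
    field_simp
    ring
  have tH := Finset.sum_range_sub (fun i => H (y i)) (2 * M)
  rw [y0, y2] at tH
  -- A left-endpoint rule on the `2M` cells, plus the one surplus node at the right end, which costs
  -- the term `B / k`.
  have key : 1 / (k : ℝ) * ∑ j ∈ Finset.Icc (-(M : ℤ)) M, h ((j : ℝ) / k)
      - (H (M / k) - H (-(M / k))) = 1 / k * h (M / k)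
        - ∑ i ∈ Finset.range (2 * M), (H (y i + 1 / k) - H (y i) - 1 / k * h (y i)) := by
    rw [hsum, Finset.sum_range_succ, y2]
    simp only [ysucc]
    rw [Finset.sum_sub_distrib, tH, ← Finset.mul_sum]
    ring
  have cell : ∀ i ∈ Finset.range (2 * M),
      |H (y i + 1 / k) - H (y i) - 1 / k * h (y i)| ≤ K * (1 / k : ℝ) ^ 2 := by
    intro i hi
    have hi' : (i : ℝ) + 1 ≤ 2 * M := by
      have := Finset.mem_range.1 hi
      exact_mod_cast this
    have hyi : -1 ≤ y i := by
      simp only [hy]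
      linarith [show (0 : ℝ) ≤ i / k by positivity]
    have hyi' : y i + 1 / k ≤ 1 := by
      have h2 : ((i : ℝ) + 1) / k ≤ 2 * M / k := by gcongr
      simp only [hy]
      have e1 : ((i : ℝ) + 1) / k = i / k + 1 / k := by ring
      have e2 : 2 * (M : ℝ) / k = M / k + M / k := by ring
      linarith
    have shift : ∀ {φ φ' : ℝ → ℝ}, (∀ u, HasDerivAt φ (φ' u) u) →
        ∀ u, HasDerivAt (fun s => φ (y i + s)) (φ' (y i + u)) u := fun hφ u =>
      (hφ (y i + u)).comp_const_add (y i) u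
    have b1 := abs_le_mul_pow_succ_of_deriv (L := 1 / k) (p := 0) hK0
      (g := fun s => h (y i + s) - h (y i)) (fun u _ => (shift dh u).sub_const _) (by simp) (by
        intro u hu
        simpa using hK (y i + u) ⟨by linarith [hu.1], by linarith [hu.2]⟩)
    have b0 := abs_le_mul_pow_succ_of_deriv (L := 1 / k) hK0
      (g := fun s => H (y i + s) - H (y i) - s * h (y i))
      (g' := fun s => h (y i + s) - h (y i)) (fun u _ => by
        simpa using! ((shift dH u).sub_const (H (y i))).sub ((hasDerivAt_id u).mul_const (h (y i))))
      (by simp) b1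
    exact b0 (1 / k) ⟨by positivity, le_rfl⟩
  rw [key]
  have hs : |∑ i ∈ Finset.range (2 * M), (H (y i + 1 / k) - H (y i) - 1 / k * h (y i))|
      ≤ 2 * K / k := by
    refine (Finset.abs_sum_le_sum_abs _ _).trans ?_
    refine (Finset.sum_le_card_nsmul _ _ _ cell).trans ?_
    rw [Finset.card_range, nsmul_eq_mul]
    push_cast
    rw [show 2 * (M : ℝ) * (K * (1 / k) ^ 2) = 2 * K / k * (M / k) by field_simp]
    exact mul_le_of_le_one_right (by positivity) hw
  have hb : |1 / (k : ℝ) * h (M / k)| ≤ B / k := by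
    rw [abs_mul, abs_of_pos (by positivity : (0 : ℝ) < 1 / k), one_div_mul_eq_div]
    gcongr
    exact hB _ ⟨by linarith, hw⟩
  calc _ ≤ _ := abs_sub _ _
    _ ≤ B / k + 2 * K / k := add_le_add hb hs
    _ = _ := by ring

end EulerMaclaurin

/-- The hypothesis says that `z` is the cotangent of the sum of the two angles; `0 < x + y` puts
that sum in `(0, π)`, so no multiple of `π` is lost. -/
lemma arctan_add_arctan_eq {x y z : ℝ} (hxy : 0 < x + y) (h : x * y + z * (x + y) = 1) :
    Real.arctan x + Real.arctan y = Real.pi / 2 - Real.arctan z := by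
  set θ := Real.arctan x + Real.arctan y with hθ
  have h0 : 0 < θ := by
    have := Real.arctan_strictMono (show -y < x by linarith)
    rw [Real.arctan_neg] at this
    linarith
  have h1 : θ < Real.pi := by
    linarith [Real.arctan_lt_pi_div_two x, Real.arctan_lt_pi_div_two y]
  have hz : Real.tan (Real.pi / 2 - θ) = z := by
    rw [Real.tan_pi_div_two_sub, Real.tan_eq_sin_div_cos, inv_div, hθ, Real.cos_add, Real.sin_add]
    have hx := Real.tan_mul_cos (Real.cos_arctan_pos x).ne'
    have hy := Real.tan_mul_cos (Real.cos_arctan_pos y).ne'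
    rw [Real.tan_arctan] at hx hy
    rw [← hx, ← hy]
    have cx := Real.cos_arctan_pos x
    have cy := Real.cos_arctan_pos y
    rw [div_eq_iff]
    · linear_combination -(Real.cos (Real.arctan x) * Real.cos (Real.arctan y)) * h
    · have : x * Real.cos (Real.arctan x) * Real.cos (Real.arctan y)
          + Real.cos (Real.arctan x) * (y * Real.cos (Real.arctan y))
          = (x + y) * (Real.cos (Real.arctan x) * Real.cos (Real.arctan y)) := by ring
      rw [this]
      positivity
  rw [← hz, Real.arctan_tan (by linarith) (by linarith)]
  ring

/-! ### Antiderivatives of the kernel, with and without a logarithmic weight. -/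

section Kernel

/-- The kernel `1 / (c + b u + a u ^ 2)`. -/
noncomputable def kern (a b c u : ℝ) : ℝ := 1 / (c + b * u + a * u ^ 2)

/-- The angle `arctan ((2 a u + b) / δ)`. -/
noncomputable def angle (a b δ u : ℝ) : ℝ := Real.arctan ((2 * a * u + b) / δ)

/-- An antiderivative of the kernel. -/
noncomputable def kernInt (a b δ u : ℝ) : ℝ := 2 / δ * angle a b δ u

/-- An antiderivative of `log |u|` times the kernel, away from `0`. -/
noncomputable def logKernInt (a b c δ u : ℝ) : ℝ :=
  2 / δ * (Real.log (c / a) / 2 * angle a b δ u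
    - clausen (2 * (angle a b δ u - angle a b δ 0)) / 2
    - clausen (Real.pi - 2 * angle a b δ u) / 2)

/-- An antiderivative of `w ↦ (kernInt w - kernInt (-w)) / w` on the positive reals. -/
noncomputable def tailInt (a b c δ w : ℝ) : ℝ :=
  (kernInt a b δ w - kernInt a b δ (-w)) * Real.log w
    - (logKernInt a b c δ w - logKernInt a b c δ (-w))

variable {a b c δ : ℝ}

lemma quad_pos (ha : 0 < a) (hδ : 0 < δ) (hd : δ ^ 2 = 4 * a * c - b ^ 2) (u : ℝ) :
    0 < c + b * u + a * u ^ 2 := by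
  nlinarith [sq_nonneg (2 * a * u + b), sq_pos_of_pos hδ]

lemma kern_pos (ha : 0 < a) (hδ : 0 < δ) (hd : δ ^ 2 = 4 * a * c - b ^ 2) (u : ℝ) :
    0 < kern a b c u := one_div_pos.2 (quad_pos ha hδ hd u)

lemma contDiff_kern (ha : 0 < a) (hδ : 0 < δ) (hd : δ ^ 2 = 4 * a * c - b ^ 2) :
    ContDiff ℝ ⊤ (kern a b c) := by
  unfold kern
  exact ContDiff.div (by fun_prop) (by fun_prop) fun u => (quad_pos ha hδ hd u).ne'

lemma hasDerivAt_kern (ha : 0 < a) (hδ : 0 < δ) (hd : δ ^ 2 = 4 * a * c - b ^ 2) (u : ℝ) :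
    HasDerivAt (kern a b c) (-(b + 2 * a * u) / (c + b * u + a * u ^ 2) ^ 2) u := by
  have h : HasDerivAt (fun u => c + b * u + a * u ^ 2) (b + 2 * a * u) u := by
    convert! (((hasDerivAt_id u).const_mul b).const_add c).add
      (((hasDerivAt_id u).pow 2).const_mul a) using 1
    simp only [id_eq]
    push_cast
    ring
  have := h.inv (quad_pos ha hδ hd u).ne'
  have e : kern a b c = (fun u => c + b * u + a * u ^ 2)⁻¹ := by
    ext u
    simp [kern]
  rw [e]
  exact this

lemma hasDerivAt_angle (ha : 0 < a) (hδ : 0 < δ) (hd : δ ^ 2 = 4 * a * c - b ^ 2) (u : ℝ) :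
    HasDerivAt (angle a b δ) (δ / 2 * kern a b c u) u := by
  have h : HasDerivAt (fun u => (2 * a * u + b) / δ) (2 * a / δ) u := by
    simpa using! (((hasDerivAt_id u).const_mul (2 * a)).add_const b).div_const δ
  convert! h.arctan using 1
  have hq := quad_pos ha hδ hd u
  have e : 1 + ((2 * a * u + b) / δ) ^ 2 = 4 * a * (c + b * u + a * u ^ 2) / δ ^ 2 := by
    field_simp
    rw [hd]
    ring
  rw [e, kern]
  field_simp
  ring

lemma hasDerivAt_kernInt (ha : 0 < a) (hδ : 0 < δ) (hd : δ ^ 2 = 4 * a * c - b ^ 2) (u : ℝ) :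
    HasDerivAt (kernInt a b δ) (kern a b c u) u := by
  convert! (hasDerivAt_angle ha hδ hd u).const_mul (2 / δ) using 1
  field_simp

lemma cos_angle_pos (u : ℝ) : 0 < Real.cos (angle a b δ u) := Real.cos_arctan_pos _

/-- With `φ` the angle, `tan φ(u) - tan φ(0) = 2 a u / δ` and `cos² φ(0) = δ² / (4 a c)`. Squaring
avoids the sign of `u` and the root of `c / a`. -/
lemma sq_mul_cos_angle_sq (ha : 0 < a) (hc : 0 < c) (hδ : 0 < δ)
    (hd : δ ^ 2 = 4 * a * c - b ^ 2) (u : ℝ) :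
    u ^ 2 * Real.cos (angle a b δ u) ^ 2
      = c / a * Real.sin (angle a b δ u - angle a b δ 0) ^ 2 := by
  have h1 := Real.tan_mul_cos (cos_angle_pos (a := a) (b := b) (δ := δ) u).ne'
  have h0 := Real.tan_mul_cos (cos_angle_pos (a := a) (b := b) (δ := δ) 0).ne'
  have hcos : Real.cos (angle a b δ 0) ^ 2 = δ ^ 2 / (4 * a * c) := by
    rw [angle, Real.cos_sq_arctan]
    have : 0 < δ ^ 2 + b ^ 2 := by positivity
    have e : 4 * a * c = δ ^ 2 + b ^ 2 := by rw [hd]; ring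
    rw [e]
    simp only [mul_zero, zero_add]
    field_simp
  simp only [angle, Real.tan_arctan, mul_zero, zero_add] at h1 h0 hcos
  rw [Real.sin_sub]
  simp only [angle, mul_zero, zero_add]
  rw [← h1, ← h0]
  have : (2 * a * u + b) / δ * Real.cos (Real.arctan ((2 * a * u + b) / δ))
        * Real.cos (Real.arctan (b / δ))
      - Real.cos (Real.arctan ((2 * a * u + b) / δ)) * (b / δ * Real.cos (Real.arctan (b / δ)))
      = 2 * a * u / δ * (Real.cos (Real.arctan ((2 * a * u + b) / δ))
        * Real.cos (Real.arctan (b / δ))) := by ring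
  rw [this, mul_pow, mul_pow, hcos]
  field_simp
  ring

lemma sin_angle_sub_ne_zero (ha : 0 < a) (hc : 0 < c) (hδ : 0 < δ)
    (hd : δ ^ 2 = 4 * a * c - b ^ 2) {u : ℝ} (hu : u ≠ 0) :
    Real.sin (angle a b δ u - angle a b δ 0) ≠ 0 := by
  intro h
  have e := sq_mul_cos_angle_sq ha hc hδ hd u
  rw [h] at e
  have := cos_angle_pos (a := a) (b := b) (δ := δ) u
  have : 0 < u ^ 2 * Real.cos (angle a b δ u) ^ 2 := by positivity
  rw [e] at this
  simp at this

/-- The two factors `2` cancel; they are inserted so that each logarithm is a derivative of the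
Clausen function. Since `dφ = (δ / 2) · kern du`, integration in `φ` yields `logKernInt`. -/
lemma log_eq_log_sin_sub_log_cos (ha : 0 < a) (hc : 0 < c) (hδ : 0 < δ)
    (hd : δ ^ 2 = 4 * a * c - b ^ 2) {u : ℝ} (hu : u ≠ 0) :
    Real.log u = Real.log (c / a) / 2 + Real.log (2 * Real.sin (angle a b δ u - angle a b δ 0))
      - Real.log (2 * Real.cos (angle a b δ u)) := by
  have e := congrArg Real.log (sq_mul_cos_angle_sq ha hc hδ hd u)
  have hs := sin_angle_sub_ne_zero ha hc hδ hd hu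
  have hcos := (cos_angle_pos (a := a) (b := b) (δ := δ) u).ne'
  rw [Real.log_mul (by positivity) (by positivity), Real.log_mul (by positivity) (by positivity),
    Real.log_pow, Real.log_pow, Real.log_pow] at e
  rw [Real.log_mul two_ne_zero hs, Real.log_mul two_ne_zero hcos]
  push_cast at e
  linarith

lemma hasDerivAt_logKernInt (ha : 0 < a) (hc : 0 < c) (hδ : 0 < δ)
    (hd : δ ^ 2 = 4 * a * c - b ^ 2) {u : ℝ} (hu : u ≠ 0) :
    HasDerivAt (logKernInt a b c δ) (Real.log u * kern a b c u) u := by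
  have hφ := hasDerivAt_angle ha hδ hd u
  have hs := sin_angle_sub_ne_zero ha hc hδ hd hu
  have hcos := (cos_angle_pos (a := a) (b := b) (δ := δ) u).ne'
  have e1 : 2 * (angle a b δ u - angle a b δ 0) / 2 = angle a b δ u - angle a b δ 0 := by ring
  have e2 : Real.sin ((Real.pi - 2 * angle a b δ u) / 2) = Real.cos (angle a b δ u) := by
    rw [← Real.sin_pi_div_two_sub]
    congr 1
    ring
  have d1 := (hasDerivAt_clausen (θ := 2 * (angle a b δ u - angle a b δ 0))
    (by rwa [e1])).comp u ((hφ.sub_const (angle a b δ 0)).const_mul 2)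
  have d2 := (hasDerivAt_clausen (θ := Real.pi - 2 * angle a b δ u)
    (by rwa [e2])).comp u ((hφ.const_mul 2).const_sub Real.pi)
  convert! (((hφ.const_mul (Real.log (c / a) / 2)).sub (d1.div_const 2)).sub
    (d2.div_const 2)).const_mul (2 / δ) using 1
  rw [e1, e2, log_eq_log_sin_sub_log_cos ha hc hδ hd hu]
  field_simp
  ring

lemma hasDerivAt_tailInt (ha : 0 < a) (hc : 0 < c) (hδ : 0 < δ)
    (hd : δ ^ 2 = 4 * a * c - b ^ 2) {w : ℝ} (hw : 0 < w) :
    HasDerivAt (tailInt a b c δ) ((kernInt a b δ w - kernInt a b δ (-w)) / w) w := by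
  have hneg : HasDerivAt (fun w : ℝ => -w) (-1) w := hasDerivAt_neg w
  have k1 := hasDerivAt_kernInt ha hδ hd w
  have k2 := (hasDerivAt_kernInt ha hδ hd (-w)).comp w hneg
  have l1 := hasDerivAt_logKernInt ha hc hδ hd hw.ne'
  have l2 := (hasDerivAt_logKernInt ha hc hδ hd (neg_ne_zero.2 hw.ne')).comp w hneg
  convert! ((k1.sub k2).mul (Real.hasDerivAt_log hw.ne')).sub (l1.sub l2) using 1
  simp only [Real.log_neg_eq_log, Pi.sub_apply, Function.comp_apply]
  ring

lemma continuous_logKernInt (ha : 0 < a) (hδ : 0 < δ) (hd : δ ^ 2 = 4 * a * c - b ^ 2) :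
    Continuous (logKernInt a b c δ) := by
  have h : Continuous (angle a b δ) :=
    continuous_iff_continuousAt.2 fun u => (hasDerivAt_angle ha hδ hd u).continuousAt
  have hcl := continuous_clausen
  unfold logKernInt
  fun_prop

/-- The increment of `kernInt` over `[-w, w]` is `O(w)` and beats `log w`; hence `tailInt` is the
antiderivative normalised to vanish at `0⁺`. -/
lemma tendsto_tailInt_zero (ha : 0 < a) (hδ : 0 < δ)
    (hd : δ ^ 2 = 4 * a * c - b ^ 2) :
    Tendsto (tailInt a b c δ) (𝓝[>] 0) (𝓝 0) := by
  have hneg : HasDerivAt (fun w : ℝ => -w) (-1) 0 := hasDerivAt_neg 0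
  have k1 := hasDerivAt_kernInt ha hδ hd 0
  have k2 := (hasDerivAt_kernInt ha hδ hd (-0)).comp 0 hneg
  have hs := (k1.sub k2).tendsto_slope
  have hs' := hs.mono_left (nhdsWithin_mono (0 : ℝ) (show Set.Ioi 0 ⊆ {0}ᶜ from fun _ hx => ne_of_gt hx))
  have hlog := tendsto_log_mul_rpow_nhdsGT_zero zero_lt_one
  have h1 := hs'.mul hlog
  rw [mul_zero] at h1
  have hG := continuous_logKernInt ha hδ hd
  have h2 : Tendsto (fun w => logKernInt a b c δ w - logKernInt a b c δ (-w)) (𝓝[>] 0) (𝓝 0) := by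
    have : Continuous fun w => logKernInt a b c δ w - logKernInt a b c δ (-w) := by fun_prop
    simpa using (this.tendsto 0).mono_left nhdsWithin_le_nhds
  have h3 := h1.sub h2
  rw [sub_zero] at h3
  refine h3.congr' ?_
  filter_upwards [self_mem_nhdsWithin] with w hw
  have hw : 0 < w := hw
  simp only [tailInt, slope_def_field, Pi.sub_apply, Function.comp_apply, neg_zero, sub_self,
    sub_zero, Real.rpow_one]
  field_simp

lemma angle_one_sub_angle_neg_one (ha : 0 < a) (hδ : 0 < δ) (hd : δ ^ 2 = 4 * a * c - b ^ 2) :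
    angle a b δ 1 - angle a b δ (-1) = Real.pi / 2 - Real.arctan ((c - a) / δ) := by
  have e : angle a b δ (-1) = -Real.arctan ((2 * a - b) / δ) := by
    rw [← Real.arctan_neg, angle]
    congr 1
    ring
  rw [e, sub_neg_eq_add, angle]
  refine arctan_add_arctan_eq ?_ ?_
  · rw [← add_div]
    apply div_pos _ hδ
    linarith
  · field_simp
    rw [hd]
    ring

/-- The values with `2a ± b` come from `π - 2 φ(±1)`, those with `2c ± b` from `φ(±1) - φ(0)` via
the cotangent addition formula. Oddness and `2π`-periodicity of the Clausen function bring all four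
to the same shape. -/
lemma logKernInt_one_sub (ha : 0 < a) (hδ : 0 < δ) (hd : δ ^ 2 = 4 * a * c - b ^ 2) :
    logKernInt a b c δ 1 - logKernInt a b c δ (-1)
      = 1 / δ * ((Real.pi / 2 - Real.arctan ((c - a) / δ)) * Real.log (c / a)
        - (clausen (Real.pi - 2 * Real.arctan ((2 * a - b) / δ))
          + clausen (Real.pi - 2 * Real.arctan ((2 * a + b) / δ))
          + clausen (Real.pi - 2 * Real.arctan ((2 * c - b) / δ))
          + clausen (Real.pi - 2 * Real.arctan ((2 * c + b) / δ)))) := by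
  have h1 := angle_one_sub_angle_neg_one ha hδ hd
  have e1 : angle a b δ 1 = Real.arctan ((2 * a + b) / δ) := by rw [angle, mul_one]
  have em : angle a b δ (-1) = -Real.arctan ((2 * a - b) / δ) := by
    rw [← Real.arctan_neg, angle]
    congr 1
    ring
  have e0 : angle a b δ 0 = -Real.arctan (-b / δ) := by
    rw [← Real.arctan_neg, angle]
    congr 1
    ring
  have e0' : angle a b δ 0 = Real.arctan (b / δ) := by
    rw [angle]
    congr 1
    ring
  have t1 : angle a b δ 1 - angle a b δ 0 = Real.pi / 2 - Real.arctan ((2 * c + b) / δ) := by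
    rw [e1, e0, sub_neg_eq_add]
    refine arctan_add_arctan_eq ?_ ?_
    · rw [← add_div]
      apply div_pos _ hδ
      linarith
    · field_simp
      rw [hd]
      ring
  have t2 : angle a b δ 0 - angle a b δ (-1) = Real.pi / 2 - Real.arctan ((2 * c - b) / δ) := by
    rw [em, e0', sub_neg_eq_add]
    refine arctan_add_arctan_eq ?_ ?_
    · rw [← add_div]
      apply div_pos _ hδ
      linarith
    · field_simp
      rw [hd]
      ring
  have c1 : clausen (2 * (angle a b δ 1 - angle a b δ 0))
      = clausen (Real.pi - 2 * Real.arctan ((2 * c + b) / δ)) := by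
    rw [t1]
    congr 1
    ring
  have c2 : clausen (2 * (angle a b δ (-1) - angle a b δ 0))
      = -clausen (Real.pi - 2 * Real.arctan ((2 * c - b) / δ)) := by
    rw [← clausen_neg]
    congr 1
    linarith
  have c3 : clausen (Real.pi - 2 * angle a b δ 1)
      = clausen (Real.pi - 2 * Real.arctan ((2 * a + b) / δ)) := by rw [e1]
  have c4 : clausen (Real.pi - 2 * angle a b δ (-1))
      = -clausen (Real.pi - 2 * Real.arctan ((2 * a - b) / δ)) := by
    rw [← clausen_neg, ← clausen_add_two_pi (-(Real.pi - _)), em]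
    congr 1
    ring
  rw [← h1]
  simp only [logKernInt, c1, c2, c3, c4]
  ring

end Kernel

lemma sum_Icc_neg_eq (m : ℕ) (g : ℤ → ℝ) :
    ∑ k ∈ Finset.Icc (-(m : ℤ)) m, g k
      = g 0 + ∑ i ∈ Finset.range m, (g (i + 1) + g (-(i + 1))) := by
  induction m with
  | zero => simp
  | succ m ih =>
    have e : Finset.Icc (-((m + 1 : ℕ) : ℤ)) ((m + 1 : ℕ) : ℤ)
        = insert ((m : ℤ) + 1) (insert (-((m : ℤ) + 1)) (Finset.Icc (-(m : ℤ)) m)) := by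
      ext k
      simp only [Finset.mem_insert, Finset.mem_Icc]
      omega
    rw [e, Finset.sum_insert, Finset.sum_insert, ih, Finset.sum_range_succ]
    · ring
    · simp only [Finset.mem_Icc]
      omega
    · simp only [Finset.mem_insert, Finset.mem_Icc]
      omega

/-! ### Sums over complete rows, by the partial fractions of the cotangent. -/

section Rows

/-- The reciprocal of the quadratic form `a j ^ 2 + b j k + c k ^ 2`. -/
noncomputable def recQuad (a b c : ℝ) (j k : ℤ) : ℝ := 1 / (a * j ^ 2 + b * j * k + c * k ^ 2)

lemma recQuad_neg_neg (a b c : ℝ) (j k : ℤ) : recQuad a b c (-j) (-k) = recQuad a b c j k := by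
  simp [recQuad]

lemma recQuad_comm (a b c : ℝ) (j k : ℤ) : recQuad a b c j k = recQuad c b a k j := by
  unfold recQuad
  congr 1
  ring

/-- Sum the geometric series in the `q`-expansion of the cotangent. Splitting `1 / (1 - w)` as `1 +
w / (1 - w)` separates the main term from the exponentially small one. -/
lemma neg_im_pi_mul_cot {z : ℂ} (hz : 0 < z.im) :
    -(Real.pi * Complex.cot (Real.pi * z)).im
      = Real.pi * (1 + 2 * (Complex.exp (2 * Real.pi * Complex.I * z)
        / (1 - Complex.exp (2 * Real.pi * Complex.I * z))).re) := by
  have h := pi_mul_cot_pi_q_exp ⟨z, hz⟩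
  have hn : ‖Complex.exp (2 * Real.pi * Complex.I * z)‖ < 1 :=
    UpperHalfPlane.norm_exp_two_pi_I_lt_one ⟨z, hz⟩
  set w := Complex.exp (2 * Real.pi * Complex.I * z) with hw
  change Real.pi * Complex.cot (Real.pi * z) = _ - _ * ∑' n : ℕ, w ^ n at h
  have h1 : 1 - w ≠ 0 := by
    intro h0
    rw [sub_eq_zero] at h0
    rw [← h0] at hn
    simp at hn
  rw [h, tsum_geometric_of_norm_lt_one hn]
  have e : (1 - w)⁻¹ = 1 + w / (1 - w) := by
    field_simp
    ring
  rw [e]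
  simp only [Complex.sub_im, Complex.mul_im, Complex.mul_re, Complex.add_re, Complex.add_im,
    Complex.ofReal_re, Complex.ofReal_im, Complex.I_re, Complex.I_im, Complex.one_re,
    Complex.one_im, Complex.re_ofNat, Complex.im_ofNat]
  ring

lemma im_one_div (w : ℂ) : (1 / w).im = -w.im / Complex.normSq w := by
  rw [one_div, Complex.inv_im]

/-- The Lipschitz-type formula for `∑ 1 / |k - z| ^ 2`. -/
lemma tendsto_sum_one_div_normSq {z : ℂ} (hz : 0 < z.im) :
    Tendsto (fun K : ℕ => ∑ k ∈ Finset.Icc (-(K : ℤ)) K, 1 / Complex.normSq (z - k)) atTop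
      (𝓝 (Real.pi / z.im * (1 + 2 * (Complex.exp (2 * Real.pi * Complex.I * z)
        / (1 - Complex.exp (2 * Real.pi * Complex.I * z))).re))) := by
  have hmem : z ∈ Complex.integerComplement :=
    UpperHalfPlane.coe_mem_integerComplement ⟨z, hz⟩
  -- Since `Im (1 / (z - k)) = -Im z / |z - k|²`, the sum is the imaginary part of the symmetric
  -- partial fractions of `π cot (π z)`, divided by `-Im z`.
  have h := (Complex.continuous_im.tendsto _).comp (tendsto_logDeriv_euler_cot_sub hmem)
  have h2 := (h.add_const ((1 / z).im)).const_mul (-1 / z.im)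
  have hlim : -1 / z.im * ((Real.pi * Complex.cot (Real.pi * z) - 1 / z).im + (1 / z).im)
      = Real.pi / z.im * (1 + 2 * (Complex.exp (2 * Real.pi * Complex.I * z)
        / (1 - Complex.exp (2 * Real.pi * Complex.I * z))).re) := by
    rw [Complex.sub_im, sub_add_cancel]
    have := neg_im_pi_mul_cot hz
    rw [div_mul_eq_mul_div, div_mul_eq_mul_div, ← this]
    ring
  rw [hlim] at h2
  refine h2.congr fun K => ?_
  rw [sum_Icc_neg_eq K fun k => 1 / Complex.normSq (z - k)]
  simp only [Function.comp_apply, Complex.im_sum]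
  rw [mul_add, add_comm, Finset.mul_sum]
  congr 1
  · rw [im_one_div]
    simp only [Int.cast_zero, sub_zero]
    field_simp
  · refine Finset.sum_congr rfl fun i _ => ?_
    change -1 / z.im * (1 / (z - (i + 1)) + 1 / (z + (i + 1))).im = _
    rw [Complex.add_im, im_one_div, im_one_div]
    push_cast
    rw [sub_neg_eq_add]
    have e1 : (z - ((i : ℂ) + 1)).im = z.im := by simp
    have e2 : (z + ((i : ℂ) + 1)).im = z.im := by simp
    rw [e1, e2]
    field_simp
    ring

variable {a b c δ : ℝ}

/-- The form factors over `ℂ` as `c |j μ - k|²` with `μ` in the upper half-plane. At the origin both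
sides are `0`, as `1 / 0 = 0`. -/
lemma recQuad_eq_normSq (hc : 0 < c) (hd : δ ^ 2 = 4 * a * c - b ^ 2) (j k : ℤ) :
    recQuad a b c j k
      = 1 / c * (1 / Complex.normSq (j * ((-b + δ * Complex.I) / (2 * c)) - k)) := by
  have ez : (j * ((-b + δ * Complex.I) / (2 * c)) - k : ℂ)
      = ((-(j * b) / (2 * c) - k : ℝ) : ℂ) + ((j * δ / (2 * c) : ℝ) : ℂ) * Complex.I := by
    push_cast
    have : (c : ℂ) ≠ 0 := by exact_mod_cast hc.ne'
    field_simp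
    ring
  rw [ez, Complex.normSq_add_mul_I, recQuad, one_div_mul_one_div]
  congr 1
  field_simp
  linear_combination (-(j : ℝ) ^ 2) * hd

/-- The sum over a row of index `j ≠ 0`. -/
lemma tendsto_row_succ (hc : 0 < c) (hδ : 0 < δ) (hd : δ ^ 2 = 4 * a * c - b ^ 2) (j : ℕ) :
    Tendsto (fun K : ℕ => ∑ k ∈ Finset.Icc (-(K : ℤ)) K, recQuad a b c (j + 1) k) atTop
      (𝓝 (2 * Real.pi / δ * (1 / (j + 1) + 2 * (1 / (j + 1) *
        (Complex.exp (2 * Real.pi * Complex.I * ((-b + δ * Complex.I) / (2 * c))) ^ (j + 1)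
        / (1 - Complex.exp (2 * Real.pi * Complex.I * ((-b + δ * Complex.I) / (2 * c)))
          ^ (j + 1)))).re))) := by
  set z : ℂ := (((j : ℤ) + 1 : ℤ) : ℂ) * ((-b + δ * Complex.I) / (2 * c)) with hz
  have him : z.im = (j + 1) * δ / (2 * c) := by
    have : z = ((-((j + 1) * b) / (2 * c) : ℝ) : ℂ)
        + (((j + 1) * δ / (2 * c) : ℝ) : ℂ) * Complex.I := by
      rw [hz]
      push_cast
      have : (c : ℂ) ≠ 0 := by exact_mod_cast hc.ne'
      field_simp
    rw [this]
    simp only [Complex.add_im, Complex.ofReal_im, Complex.mul_I_im, Complex.ofReal_re, zero_add]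
  have hpos : 0 < z.im := by rw [him]; positivity
  have h := (tendsto_sum_one_div_normSq hpos).const_mul (1 / c)
  have hexp : Complex.exp (2 * Real.pi * Complex.I * z)
      = Complex.exp (2 * Real.pi * Complex.I * ((-b + δ * Complex.I) / (2 * c))) ^ (j + 1) := by
    rw [← Complex.exp_nat_mul, hz]
    congr 1
    push_cast
    ring
  rw [hexp, him] at h
  set w := Complex.exp (2 * Real.pi * Complex.I * ((-b + δ * Complex.I) / (2 * c))) ^ (j + 1)
  have hre : ((1 : ℂ) / (j + 1) * (w / (1 - w))).re = 1 / (j + 1) * (w / (1 - w)).re := by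
    rw [← Complex.re_ofReal_mul]
    push_cast
    rfl
  rw [hre]
  convert! h using 2
  · rw [Finset.mul_sum]
    exact Finset.sum_congr rfl fun k _ => recQuad_eq_normSq hc hd _ _
  · field_simp

/-- The sum over the row of index `0`. -/
lemma tendsto_row_zero (a b c : ℝ) :
    Tendsto (fun K : ℕ => ∑ k ∈ Finset.Icc (-(K : ℤ)) K, recQuad a b c 0 k) atTop
      (𝓝 (Real.pi ^ 2 / (3 * c))) := by
  have h := ((hasSum_nat_add_iff' 1).2 hasSum_zeta_two).tendsto_sum_nat.const_mul (2 / c)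
  have hlim : 2 / c * (Real.pi ^ 2 / 6 - ∑ i ∈ Finset.range 1, (1 : ℝ) / (i : ℝ) ^ 2)
      = Real.pi ^ 2 / (3 * c) := by
    simp
    ring
  rw [hlim] at h
  refine h.congr fun K => ?_
  rw [sum_Icc_neg_eq, Finset.mul_sum]
  simp only [recQuad]
  push_cast
  -- The term `k = 0` is `1 / 0 = 0`, so the row is twice `ζ(2) / c`.
  simp only [mul_zero, zero_mul, zero_add, ne_eq, OfNat.ofNat_ne_zero, not_false_eq_true, zero_pow,
    add_zero, div_zero]
  refine Finset.sum_congr rfl fun i _ => ?_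
  rw [neg_sq, ← two_mul, div_mul_div_comm, mul_one, mul_one_div]

end Rows

/-! ### Lambert series, the eta product and Kronecker's limit formula. -/

section Eta

/-- As `(j + 1)(m + 1) ≥ j + m`, a product of two geometric series dominates; this justifies
interchanging the double sum below. -/
lemma summable_lambert {w : ℂ} (hw : ‖w‖ < 1) :
    Summable fun p : ℕ × ℕ => (w ^ (p.2 + 1)) ^ (p.1 + 1) / ((p.1 : ℂ) + 1) := by
  have hg := summable_geometric_of_lt_one (norm_nonneg w) hw
  have h := hg.mul_of_nonneg hg (fun n => pow_nonneg (norm_nonneg w) n)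
    (fun n => pow_nonneg (norm_nonneg w) n)
  refine Summable.of_norm_bounded h fun p => ?_
  rw [norm_div, norm_pow, norm_pow, ← pow_mul, ← pow_add]
  have h1 : (1 : ℝ) ≤ ‖(p.1 : ℂ) + 1‖ := by
    have : ((p.1 : ℂ) + 1) = ((p.1 + 1 : ℕ) : ℂ) := by push_cast; rfl
    rw [this, Complex.norm_natCast]
    exact_mod_cast Nat.le_add_left 1 p.1
  refine (div_le_self (by positivity) h1).trans ?_
  exact pow_le_pow_of_le_one (norm_nonneg w) hw.le (by nlinarith)

/-- The norm of the exponential of a sum of principal logarithms sees only its real part, so the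
branch of the total logarithm is irrelevant. -/
lemma log_norm_tprod_one_sub_pow {w : ℂ} (hw : ‖w‖ < 1) :
    Real.log ‖∏' n : ℕ, (1 - w ^ (n + 1))‖ = (∑' n : ℕ, Complex.log (1 - w ^ (n + 1))).re := by
  have hs : Summable fun n : ℕ => Complex.log (1 - w ^ (n + 1)) := by
    have h := Complex.summable_log_one_add_of_summable (f := fun n : ℕ => -w ^ (n + 1)) (by
      refine Summable.neg ((summable_nat_add_iff 1).2 ?_)
      exact summable_geometric_of_norm_lt_one hw)
    simpa only [← sub_eq_add_neg] using h
  have hne : ∀ n : ℕ, 1 - w ^ (n + 1) ≠ 0 := fun n h0 => by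
    have h1 : ‖w ^ (n + 1)‖ < 1 := by
      rw [norm_pow]
      exact pow_lt_one₀ (norm_nonneg w) hw (Nat.succ_ne_zero n)
    rw [← sub_eq_zero.1 h0] at h1
    simp at h1
  rw [← Complex.cexp_tsum_eq_tprod hne hs, Complex.norm_exp, Real.log_exp]

/-- Expand `w^j / (1 - w^j)` as `∑ₘ w^(m j)`, interchange, and recognise the logarithm series in
`j`. -/
lemma tendsto_lambert_sum {w : ℂ} (hw : ‖w‖ < 1) :
    Tendsto (fun M : ℕ => ∑ j ∈ Finset.range M,
      ((1 : ℂ) / (j + 1) * (w ^ (j + 1) / (1 - w ^ (j + 1)))).re) atTop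
      (𝓝 (-Real.log ‖∏' n : ℕ, (1 - w ^ (n + 1))‖)) := by
  have hs := summable_lambert hw
  have hpow : ∀ n : ℕ, ‖w ^ (n + 1)‖ < 1 := fun n => by
    rw [norm_pow]
    exact pow_lt_one₀ (norm_nonneg w) hw (Nat.succ_ne_zero n)
  have hrow : ∀ j : ℕ, ∑' m : ℕ, (w ^ (m + 1)) ^ (j + 1) / ((j : ℂ) + 1)
      = 1 / (j + 1) * (w ^ (j + 1) / (1 - w ^ (j + 1))) := fun j => by
    have e : ∀ m : ℕ, (w ^ (m + 1)) ^ (j + 1) / ((j : ℂ) + 1)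
        = 1 / (j + 1) * w ^ (j + 1) * (w ^ (j + 1)) ^ m := fun m => by
      rw [← pow_mul, ← pow_mul]
      have : w ^ ((m + 1) * (j + 1)) = w ^ (j + 1) * w ^ ((j + 1) * m) := by
        rw [← pow_add]
        congr 1
        ring
      rw [this]
      ring
    simp_rw [e]
    rw [tsum_mul_left, tsum_geometric_of_norm_lt_one (hpow j)]
    ring
  have hcol : ∀ m : ℕ, ∑' j : ℕ, (w ^ (m + 1)) ^ (j + 1) / ((j : ℂ) + 1)
      = -Complex.log (1 - w ^ (m + 1)) := fun m =>
    (Complex.hasSum_taylorSeries_neg_log' (hpow m)).tsum_eq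
  have hcomm : ∑' j : ℕ, ((1 : ℂ) / (j + 1) * (w ^ (j + 1) / (1 - w ^ (j + 1))))
      = -∑' m : ℕ, Complex.log (1 - w ^ (m + 1)) := by
    rw [← tsum_neg, ← tsum_congr hrow, ← tsum_congr hcol]
    exact (Summable.tsum_comm (f := fun j m : ℕ => (w ^ (m + 1)) ^ (j + 1) / ((j : ℂ) + 1)) hs).symm
  have hsum : Summable fun j : ℕ => (1 : ℂ) / (j + 1) * (w ^ (j + 1) / (1 - w ^ (j + 1))) :=
    hs.prod.congr hrow
  have h := (Complex.hasSum_re hsum.hasSum).tendsto_sum_nat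
  rwa [hcomm, Complex.neg_re, ← log_norm_tprod_one_sub_pow hw] at h

lemma log_norm_eta {z : ℂ} (hz : 0 < z.im) :
    Real.log ‖ModularForm.eta z‖ = -Real.pi * z.im / 12
      + Real.log ‖∏' n : ℕ, (1 - Complex.exp (2 * Real.pi * Complex.I * z) ^ (n + 1))‖ := by
  have hne := ModularForm.eta_tprod_ne_zero (z := z) hz
  rw [ModularForm.eta, norm_mul, Real.log_mul (by simp [Function.Periodic.qParam])
    (norm_ne_zero_iff.2 hne), Function.Periodic.norm_qParam, Real.log_exp]
  simp only [ModularForm.eta_q_eq_pow]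
  ring

variable {a b c δ : ℝ}

/-- Kronecker's limit formula for the sums over complete rows. -/
theorem exists_row_sums (hc : 0 < c) (hδ : 0 < δ) (hd : δ ^ 2 = 4 * a * c - b ^ 2) :
    ∃ R : ℕ → ℝ,
      (∀ j : ℕ, Tendsto (fun K : ℕ => ∑ k ∈ Finset.Icc (-(K : ℤ)) K, recQuad a b c j k) atTop
        (𝓝 (R j))) ∧
      Tendsto (fun M : ℕ => R 0 + 2 * ∑ j ∈ Finset.range M, R (j + 1)
          - 4 * Real.pi / δ * Real.log M) atTop
        (𝓝 (4 * Real.pi / δ * Real.eulerMascheroniConstant - 8 * Real.pi / δ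
          * Real.log ‖ModularForm.eta ((-b + δ * Complex.I) / (2 * c))‖)) := by
  set z : ℂ := (-b + δ * Complex.I) / (2 * c) with hz
  have him : z.im = δ / (2 * c) := by
    have : z = ((-b / (2 * c) : ℝ) : ℂ) + ((δ / (2 * c) : ℝ) : ℂ) * Complex.I := by
      rw [hz]
      push_cast
      ring
    rw [this]
    simp only [Complex.add_im, Complex.ofReal_im, Complex.mul_I_im, Complex.ofReal_re, zero_add]
  have hpos : 0 < z.im := by rw [him]; positivity
  set w := Complex.exp (2 * Real.pi * Complex.I * z) with hw
  have hn : ‖w‖ < 1 := UpperHalfPlane.norm_exp_two_pi_I_lt_one ⟨z, hpos⟩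
  let S : ℕ → ℝ := fun j => 2 * Real.pi / δ * (1 / (j + 1) + 2 * ((1 : ℂ) / (j + 1) *
        (w ^ (j + 1) / (1 - w ^ (j + 1)))).re)
  refine ⟨fun j => Nat.casesOn j (Real.pi ^ 2 / (3 * c)) S, ?_, ?_⟩
  · rintro (_ | j)
    · exact tendsto_row_zero a b c
    · simpa only [Nat.cast_add, Nat.cast_one] using tendsto_row_succ hc hδ hd j
  · have h1 := Real.tendsto_harmonic_sub_log.const_mul (4 * Real.pi / δ)
    have h2 := (tendsto_lambert_sum hn).const_mul (8 * Real.pi / δ)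
    have h3 := (h1.add h2).const_add (Real.pi ^ 2 / (3 * c))
    -- The row of index `0` contributes `π² / (3c)`, exactly `-8π / δ` times the logarithm `-π Im μ
    -- / 12` of the prefactor of `η`.
    rw [log_norm_eta hpos, him]
    convert! h3 using 2
    · rename_i M
      have hh : (harmonic M : ℝ) = ∑ j ∈ Finset.range M, 1 / ((j : ℝ) + 1) := by
        simp [harmonic]
      have hS : 2 * ∑ j ∈ Finset.range M, S j
          = 4 * Real.pi / δ * ∑ j ∈ Finset.range M, 1 / ((j : ℝ) + 1)
            + 8 * Real.pi / δ * ∑ j ∈ Finset.range M,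
              ((1 : ℂ) / (j + 1) * (w ^ (j + 1) / (1 - w ^ (j + 1)))).re := by
        rw [Finset.mul_sum, Finset.mul_sum, Finset.mul_sum, ← Finset.sum_add_distrib]
        refine Finset.sum_congr rfl fun j _ => ?_
        simp only [S]
        ring
      change Real.pi ^ 2 / (3 * c) + 2 * ∑ j ∈ Finset.range M, S j - _ = _
      rw [hh]
      linear_combination hS
    · field_simp
      ring

end Eta

lemma sum_Icc_neg_comp_neg (m : ℕ) (g : ℤ → ℝ) :
    ∑ k ∈ Finset.Icc (-(m : ℤ)) m, g (-k) = ∑ k ∈ Finset.Icc (-(m : ℤ)) m, g k := by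
  rw [sum_Icc_neg_eq m g, sum_Icc_neg_eq m fun k => g (-k)]
  simp only [neg_zero, neg_neg]
  congr 1
  exact Finset.sum_congr rfl fun i _ => add_comm _ _

/-- The sum of the reciprocal quadratic form over the square `[-M, M] ^ 2`. -/
noncomputable def boxSum (a b c : ℝ) (M : ℕ) : ℝ :=
  ∑ j ∈ Finset.Icc (-(M : ℤ)) M, ∑ k ∈ Finset.Icc (-(M : ℤ)) M, recQuad a b c j k

/-! ### From rows to squares: the strips above and below. -/

section Tail

variable {a b c δ : ℝ}

/-- What is left of the rows `|j| ≤ M`, cut at `|k| ≤ K`, is a pair of strips `M < |k| ≤ K`,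
exchanged by the symmetry through the origin. -/
lemma sum_rows_sub_boxSum (a b c : ℝ) {M K : ℕ} (hMK : M ≤ K) :
    ∑ k ∈ Finset.Icc (-(K : ℤ)) K, recQuad a b c 0 k
      + 2 * ∑ j ∈ Finset.range M, ∑ k ∈ Finset.Icc (-(K : ℤ)) K, recQuad a b c (j + 1) k
      - boxSum a b c M
      = 2 * ∑ i ∈ Finset.Ico M K, ∑ j ∈ Finset.Icc (-(M : ℤ)) M, recQuad a b c j (i + 1) := by
  have hrow : ∀ j : ℤ, ∑ k ∈ Finset.Icc (-(K : ℤ)) K, recQuad a b c (-j) k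
      = ∑ k ∈ Finset.Icc (-(K : ℤ)) K, recQuad a b c j k := fun j => by
    rw [← sum_Icc_neg_comp_neg]
    simp only [recQuad_neg_neg]
  have h1 : ∑ k ∈ Finset.Icc (-(K : ℤ)) K, recQuad a b c 0 k
      + 2 * ∑ j ∈ Finset.range M, ∑ k ∈ Finset.Icc (-(K : ℤ)) K, recQuad a b c (j + 1) k
      = ∑ j ∈ Finset.Icc (-(M : ℤ)) M, ∑ k ∈ Finset.Icc (-(K : ℤ)) K, recQuad a b c j k := by
    rw [sum_Icc_neg_eq M fun j => ∑ k ∈ Finset.Icc (-(K : ℤ)) K, recQuad a b c j k]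
    simp only [hrow, ← two_mul, Finset.mul_sum]
  have h2 : ∀ j : ℤ, ∑ k ∈ Finset.Icc (-(K : ℤ)) K, recQuad a b c j k
      - ∑ k ∈ Finset.Icc (-(M : ℤ)) M, recQuad a b c j k
      = ∑ i ∈ Finset.Ico M K, (recQuad a b c j (i + 1) + recQuad a b c j (-(i + 1))) := fun j => by
    rw [sum_Icc_neg_eq, sum_Icc_neg_eq, Finset.sum_Ico_eq_sub _ hMK]
    ring
  rw [h1, boxSum, ← Finset.sum_sub_distrib, Finset.sum_congr rfl fun j _ => h2 j,
    Finset.sum_comm, Finset.mul_sum]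
  refine Finset.sum_congr rfl fun i _ => ?_
  rw [Finset.sum_add_distrib, two_mul]
  congr 1
  rw [← sum_Icc_neg_comp_neg]
  simp only [recQuad_neg_neg]

lemma recQuad_eq_kern (a b c : ℝ) (j : ℤ) {k : ℕ} (hk : k ≠ 0) :
    recQuad a b c j k = 1 / (k : ℝ) * (1 / k * kern a b c (j / k)) := by
  have : (k : ℝ) ≠ 0 := by exact_mod_cast hk
  rw [recQuad, kern, one_div_mul_one_div, one_div_mul_one_div]
  congr 1
  push_cast
  field_simp
  ring

lemma exists_bound_on_Icc {g : ℝ → ℝ} (hg : Continuous g) :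
    ∃ K, ∀ u ∈ Set.Icc (-1 : ℝ) 1, |g u| ≤ K :=
  isCompact_Icc.exists_bound_of_continuousOn hg.continuousOn

/-- By homogeneity of degree `-2` the segment at height `k` is `1 / k` times a Riemann sum of the
kernel with step `1 / k`. -/
lemma exists_row_segment_bound (ha : 0 < a) (hδ : 0 < δ) (hd : δ ^ 2 = 4 * a * c - b ^ 2) :
    ∃ C, 0 ≤ C ∧ ∀ M k : ℕ, 1 ≤ k → M ≤ k →
      |∑ j ∈ Finset.Icc (-(M : ℤ)) M, recQuad a b c j k
        - (kernInt a b δ (M / k) - kernInt a b δ (-(M / k))) / k| ≤ C / (k : ℝ) ^ 2 := by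
  have hsm := contDiff_kern ha hδ hd
  obtain ⟨B, hB⟩ := exists_bound_on_Icc hsm.continuous
  obtain ⟨K, hK⟩ := exists_bound_on_Icc (hsm.continuous_deriv le_top)
  have hd1 : ∀ u, HasDerivAt (kern a b c) (deriv (kern a b c) u) u := fun u =>
    (hasDerivAt_kern ha hδ hd u).differentiableAt.hasDerivAt
  have hB0 : 0 ≤ B := (abs_nonneg _).trans (hB 0 (by norm_num))
  have hK0 : 0 ≤ K := (abs_nonneg _).trans (hK 0 (by norm_num))
  refine ⟨2 * K + B, by positivity, fun M k hk hMk => ?_⟩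
  have hk0 : (0 : ℝ) < k := by exact_mod_cast hk
  have h := riemann_sum (hasDerivAt_kernInt ha hδ hd) hd1 hK hB hk hMk
  have e : ∑ j ∈ Finset.Icc (-(M : ℤ)) M, recQuad a b c j k
        - (kernInt a b δ (M / k) - kernInt a b δ (-(M / k))) / k
      = 1 / k * (1 / (k : ℝ) * ∑ j ∈ Finset.Icc (-(M : ℤ)) M, kern a b c ((j : ℝ) / k)
      - (kernInt a b δ (M / k) - kernInt a b δ (-(M / k)))) := by
    rw [Finset.sum_congr rfl fun j _ => recQuad_eq_kern a b c j (by omega : k ≠ 0),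
      ← Finset.mul_sum, ← Finset.mul_sum]
    ring
  rw [e, abs_mul, abs_of_pos (by positivity : (0 : ℝ) < 1 / k)]
  calc 1 / (k : ℝ) * _ ≤ 1 / k * ((2 * K + B) / k) := by gcongr
    _ = _ := by field_simp

lemma strictMono_kernInt (ha : 0 < a) (hδ : 0 < δ) (hd : δ ^ 2 = 4 * a * c - b ^ 2) :
    StrictMono (kernInt a b δ) :=
  strictMono_of_hasDerivAt_pos (fun u => hasDerivAt_kernInt ha hδ hd u)
    fun u => kern_pos ha hδ hd u

lemma segment_antitone (ha : 0 < a) (hδ : 0 < δ) (hd : δ ^ 2 = 4 * a * c - b ^ 2) {M x y : ℝ}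
    (hM : 0 ≤ M) (hx : 0 < x) (hxy : x ≤ y) :
    (kernInt a b δ (M / y) - kernInt a b δ (-(M / y))) / y
      ≤ (kernInt a b δ (M / x) - kernInt a b δ (-(M / x))) / x := by
  have hm := (strictMono_kernInt ha hδ hd).monotone
  have h1 : M / y ≤ M / x := by gcongr
  have h0 : 0 ≤ M / y := div_nonneg hM (hx.trans_le hxy).le
  have e1 := hm h1
  have e2 := hm (neg_le_neg h1)
  have e3 := hm (show -(M / y) ≤ M / y by linarith)
  exact div_le_div₀ (by linarith) (by linarith) hx hxy

/-- Integral comparison: `u ↦ -tailInt (M / u)` has the main term of the segment at height `u` as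
its derivative, and that derivative is antitone, so the mean value theorem gives the sandwich. -/
lemma tailInt_sub_mem (ha : 0 < a) (hc : 0 < c) (hδ : 0 < δ) (hd : δ ^ 2 = 4 * a * c - b ^ 2)
    {M x y : ℝ} (hM : 0 < M) (hx : 0 < x) (hxy : y = x + 1) :
    (kernInt a b δ (M / y) - kernInt a b δ (-(M / y))) / y
        ≤ tailInt a b c δ (M / x) - tailInt a b c δ (M / y) ∧
      tailInt a b c δ (M / x) - tailInt a b c δ (M / y)
        ≤ (kernInt a b δ (M / x) - kernInt a b δ (-(M / x))) / x := by
  have hder : ∀ u, 0 < u → HasDerivAt (fun u => -tailInt a b c δ (M / u))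
      ((kernInt a b δ (M / u) - kernInt a b δ (-(M / u))) / u) u := fun u hu => by
    have h1 : HasDerivAt (fun u => M / u) (-M / u ^ 2) u := by
      simpa [div_eq_mul_inv] using! (hasDerivAt_inv hu.ne').const_mul M
    convert! ((hasDerivAt_tailInt ha hc hδ hd (div_pos hM hu)).comp u h1).neg using 1
    field_simp
  obtain ⟨ξ, hξ, e⟩ := exists_hasDerivAt_eq_slope (fun u => -tailInt a b c δ (M / u))
    (fun u => (kernInt a b δ (M / u) - kernInt a b δ (-(M / u))) / u) (show x < y by linarith)
    (fun u hu => (hder u (hx.trans_le hu.1)).continuousAt.continuousWithinAt)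
    (fun u hu => hder u (hx.trans hu.1))
  have e' : tailInt a b c δ (M / x) - tailInt a b c δ (M / y)
      = (kernInt a b δ (M / ξ) - kernInt a b δ (-(M / ξ))) / ξ := by
    rw [e, hxy, add_sub_cancel_left, div_one]
    ring
  rw [e']
  exact ⟨segment_antitone ha hδ hd hM.le (hx.trans hξ.1) hξ.2.le,
    segment_antitone ha hδ hd hM.le hx hξ.1.le⟩

/-- Uniformity in `K` is the point: `K → ∞` is taken at fixed `M`, and only then `M → ∞`. -/
lemma exists_tail_bound (ha : 0 < a) (hc : 0 < c) (hδ : 0 < δ)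
    (hd : δ ^ 2 = 4 * a * c - b ^ 2) :
    ∃ C, ∀ M K : ℕ, 1 ≤ M → M ≤ K →
      |∑ i ∈ Finset.Ico M K, ∑ j ∈ Finset.Icc (-(M : ℤ)) M, recQuad a b c j (i + 1)
        - (tailInt a b c δ 1 - tailInt a b c δ (M / K))| ≤ C / M := by
  obtain ⟨C, hC0, hC⟩ := exists_row_segment_bound ha hδ hd
  have hmono := (strictMono_kernInt ha hδ hd).monotone
  refine ⟨C + (kernInt a b δ 1 - kernInt a b δ (-1)), fun M K hM hMK => ?_⟩
  have hM0 : (0 : ℝ) < M := by exact_mod_cast hM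
  set e : ℕ → ℝ := fun i => (kernInt a b δ (M / i) - kernInt a b δ (-(M / i))) / i with he
  set P : ℕ → ℝ := fun i => tailInt a b c δ (M / i) with hP
  have hPM : P M = tailInt a b c δ 1 := by simp only [hP]; rw [div_self hM0.ne']
  have heM : e M = (kernInt a b δ 1 - kernInt a b δ (-1)) / M := by
    simp only [he]
    rw [div_self hM0.ne']
  have heK : 0 ≤ e K := by
    have h0 : (0 : ℝ) ≤ M / K := by positivity
    have := hmono (show -((M : ℝ) / K) ≤ M / K by linarith)
    exact div_nonneg (by linarith) (by positivity)
  have tP : ∑ i ∈ Finset.Ico M K, (P i - P (i + 1)) = P M - P K := by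
    have := Finset.sum_Ico_sub P hMK
    rw [← neg_sub (P K), ← this, ← Finset.sum_neg_distrib]
    simp
  have te : ∑ i ∈ Finset.Ico M K, (e i - e (i + 1)) = e M - e K := by
    have := Finset.sum_Ico_sub e hMK
    rw [← neg_sub (e K), ← this, ← Finset.sum_neg_distrib]
    simp
  have tr : ∑ i ∈ Finset.Ico M K, (1 / (i : ℝ) - 1 / ((i + 1 : ℕ) : ℝ)) = 1 / M - 1 / K := by
    have := Finset.sum_Ico_sub (fun i : ℕ => 1 / (i : ℝ)) hMK
    rw [← neg_sub (1 / (K : ℝ)), ← this, ← Finset.sum_neg_distrib]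
    simp
  have key : ∑ i ∈ Finset.Ico M K, ∑ j ∈ Finset.Icc (-(M : ℤ)) M, recQuad a b c j (i + 1)
        - (tailInt a b c δ 1 - tailInt a b c δ (M / K))
      = ∑ i ∈ Finset.Ico M K, (∑ j ∈ Finset.Icc (-(M : ℤ)) M, recQuad a b c j (i + 1)
        - (P i - P (i + 1))) := by
    rw [Finset.sum_sub_distrib, tP, hPM]
  rw [key]
  refine (Finset.abs_sum_le_sum_abs _ _).trans ?_
  -- Two errors per segment: the Riemann sum error, at most `C (1 / i - 1 / (i + 1))`, and the
  -- integral comparison, at most `e i - e (i + 1)`. Both telescope to `O(1 / M)`.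
  have hterm : ∀ i ∈ Finset.Ico M K,
      |∑ j ∈ Finset.Icc (-(M : ℤ)) M, recQuad a b c j (i + 1) - (P i - P (i + 1))|
        ≤ C * (1 / (i : ℝ) - 1 / ((i + 1 : ℕ) : ℝ)) + (e i - e (i + 1)) := by
    intro i hi
    have hi := Finset.mem_Ico.1 hi
    have hi0 : (0 : ℝ) < i := by exact_mod_cast lt_of_lt_of_le hM hi.1
    have h1 := hC M (i + 1) (by omega) (by omega)
    have h2 := tailInt_sub_mem ha hc hδ hd hM0 hi0 (Nat.cast_succ i)
    have h3 : C / ((i + 1 : ℕ) : ℝ) ^ 2 ≤ C * (1 / (i : ℝ) - 1 / ((i + 1 : ℕ) : ℝ)) := by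
      rw [div_eq_mul_one_div]
      refine mul_le_mul_of_nonneg_left ?_ hC0
      push_cast
      rw [div_sub_div _ _ hi0.ne' (by positivity), div_le_div_iff₀ (by positivity) (by positivity)]
      nlinarith
    change |_ - e (i + 1)| ≤ _ at h1
    change e (i + 1) ≤ P i - P (i + 1) ∧ P i - P (i + 1) ≤ e i at h2
    push_cast at h1
    rw [abs_le] at h1 ⊢
    push_cast at h3 ⊢
    constructor <;> linarith [h1.1, h1.2, h2.1, h2.2]
  refine (Finset.sum_le_sum hterm).trans ?_
  rw [Finset.sum_add_distrib, ← Finset.mul_sum, te, tr, heM]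
  have : C * (1 / M - 1 / (K : ℝ)) ≤ C * (1 / M) := by
    refine mul_le_mul_of_nonneg_left ?_ hC0
    linarith [show (0 : ℝ) ≤ 1 / K by positivity]
  rw [add_div, div_eq_mul_one_div C]
  linarith

/-- The constant term of the sums over the squares `[-M, M] ^ 2`. -/
theorem tendsto_boxSum_sub_log (ha : 0 < a) (hc : 0 < c) (hδ : 0 < δ)
    (hd : δ ^ 2 = 4 * a * c - b ^ 2) :
    Tendsto (fun M : ℕ => boxSum a b c M - 4 * Real.pi / δ * Real.log M) atTop
      (𝓝 (4 * Real.pi / δ * Real.eulerMascheroniConstant - 8 * Real.pi / δ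
          * Real.log ‖ModularForm.eta ((-b + δ * Complex.I) / (2 * c))‖
        + 2 * (logKernInt a b c δ 1 - logKernInt a b c δ (-1)))) := by
  obtain ⟨R, hR, hlim⟩ := exists_row_sums hc hδ hd
  obtain ⟨C, hC⟩ := exists_tail_bound ha hc hδ hd
  have hP1 : tailInt a b c δ 1 = -(logKernInt a b c δ 1 - logKernInt a b c δ (-1)) := by
    simp [tailInt]
  have hbound : ∀ M : ℕ, 1 ≤ M → |R 0 + 2 * ∑ j ∈ Finset.range M, R (j + 1) - boxSum a b c M
      - 2 * tailInt a b c δ 1| ≤ 2 * (C / M) := by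
    intro M hM
    have hM0 : (0 : ℝ) < M := by exact_mod_cast hM
    -- As `K → ∞` the truncated rows become complete and the lower end `tailInt (M / K)` disappears.
    have hw : Tendsto (fun K : ℕ => (M : ℝ) / K) atTop (𝓝[>] 0) := by
      refine tendsto_nhdsWithin_iff.2 ⟨tendsto_const_div_atTop_nhds_zero_nat _, ?_⟩
      filter_upwards [eventually_gt_atTop 0] with K hK
      have : (0 : ℝ) < K := by exact_mod_cast hK
      exact div_pos hM0 this
    have hP := (tendsto_tailInt_zero ha hδ hd).comp hw
    have hrows := ((hR 0).add ((tendsto_finsetSum (Finset.range M)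
      fun j _ => hR (j + 1)).const_mul 2)).sub_const (boxSum a b c M)
    have hall := (hrows.sub ((hP.const_sub (tailInt a b c δ 1)).const_mul 2)).abs
    rw [sub_zero] at hall
    refine le_of_tendsto hall ?_
    filter_upwards [eventually_ge_atTop M] with K hK
    have e := sum_rows_sub_boxSum a b c hK
    have h := hC M K hM hK
    push_cast
    rw [e, Function.comp_apply, ← mul_sub, abs_mul, abs_two]
    exact mul_le_mul_of_nonneg_left h zero_le_two
  have hzero : Tendsto (fun M : ℕ => R 0 + 2 * ∑ j ∈ Finset.range M, R (j + 1) - boxSum a b c M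
      - 2 * tailInt a b c δ 1) atTop (𝓝 0) := by
    refine squeeze_zero_norm' (a := fun M : ℕ => 2 * (C / (M : ℝ))) ?_ ?_
    · filter_upwards [eventually_ge_atTop 1] with M hM using hbound M hM
    · simpa using (tendsto_const_div_atTop_nhds_zero_nat C).const_mul 2
  have h := (hlim.sub hzero).sub_const (2 * tailInt a b c δ 1)
  convert! h using 2
  · ring
  · rw [hP1]
    ring

end Tail

/-! ### Elementary expansions with explicit remainders. -/

section Expansions

/-- The increment of `log` between the half-integers around `m` is odd in `1 / m`, so it has no
`m⁻²` or `m⁻⁴` term. This is why the ansatz for the closed squares uses `M + 1/2`. -/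
lemma abs_log_div_sub_le {m : ℝ} (hm : 1 ≤ m) :
    |Real.log (m + 1 / 2) - Real.log (m - 1 / 2) - 1 / m - 1 / (12 * m ^ 3)| ≤ 1 / m ^ 5 := by
  -- Here `t = 1 / (2m) ≤ 1/2`, so `1 - t² ≥ 3/4`, and the derivative `2 t⁴ / (1 - t²)` is at most
  -- `8/3 t⁴`.
  have h := abs_le_mul_pow_succ_of_deriv (L := 1 / 2) (p := 4) (K := 8 / 3) (by norm_num)
    (g := fun t => Real.log (1 + t) - Real.log (1 - t) - 2 * t - 2 / 3 * t ^ 3)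
    (g' := fun t => 2 * t ^ 4 / (1 - t ^ 2)) (fun t ht => by
      have h1 : 1 + t ≠ 0 := by linarith [ht.1]
      have h2 : 1 - t ≠ 0 := by linarith [ht.2]
      have h3 : 1 - t ^ 2 ≠ 0 := by
        rw [show 1 - t ^ 2 = (1 + t) * (1 - t) by ring]
        exact mul_ne_zero h1 h2
      have hid := hasDerivAt_id t
      convert! ((((hid.const_add 1).log h1).sub ((hid.const_sub 1).log h2)).sub
        (hid.const_mul 2)).sub ((hid.pow 3).const_mul (2 / 3)) using 1
      simp only [id_eq]
      have h3' : 1 - t ^ 2 = (1 + t) * (1 - t) := by ring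
      rw [h3']
      push_cast
      field_simp
      ring)
    (by simp) (fun t ht => by
      have h3 : 3 / 4 ≤ 1 - t ^ 2 := by nlinarith [ht.1, ht.2]
      rw [abs_of_nonneg (by positivity), div_le_iff₀ (by linarith)]
      nlinarith [pow_nonneg ht.1 4])
    (1 / (2 * m)) ⟨by positivity, by
      rw [div_le_div_iff₀ (by positivity) (by norm_num)]
      linarith⟩
  have e1 : Real.log (m + 1 / 2) = Real.log m + Real.log (1 + 1 / (2 * m)) := by
    rw [← Real.log_mul (by positivity) (by positivity)]
    congr 1
    field_simp
  have hpos : 0 < 1 - 1 / (2 * m) := by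
    rw [sub_pos, div_lt_one (by positivity)]
    linarith
  have e2 : Real.log (m - 1 / 2) = Real.log m + Real.log (1 - 1 / (2 * m)) := by
    rw [← Real.log_mul (by positivity) hpos.ne']
    congr 1
    field_simp
  have e3 : Real.log (m + 1 / 2) - Real.log (m - 1 / 2) - 1 / m - 1 / (12 * m ^ 3)
      = Real.log (1 + 1 / (2 * m)) - Real.log (1 - 1 / (2 * m)) - 2 * (1 / (2 * m))
        - 2 / 3 * (1 / (2 * m)) ^ 3 := by
    rw [e1, e2]
    field_simp
    ring
  rw [e3]
  refine h.trans ?_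
  rw [show (8 / 3 : ℝ) * (1 / (2 * m)) ^ (4 + 1) = 1 / 12 * (1 / m ^ 5) by ring]
  have : 0 ≤ 1 / m ^ 5 := by positivity
  linarith

lemma abs_inv_sq_sub_le {m : ℝ} (hm : 1 ≤ m) :
    |1 / (m + 1 / 2) ^ 2 - 1 / (m - 1 / 2) ^ 2 + 2 / m ^ 3| ≤ 2 / m ^ 5 := by
  have h1 : 0 < m - 1 / 2 := by linarith
  have e : ∀ x : ℝ, 0 < x → 1 / (x + 1) ^ 2 - 1 / x ^ 2 + 2 / (x + 1 / 2) ^ 3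
      = -(((x + 1 / 2) ^ 2 - 1 / 8) / ((x + 1 / 2) ^ 3 * ((x + 1) * x) ^ 2)) := by
    intro x hx
    field_simp
    ring
  have e := e (m - 1 / 2) h1
  rw [show m - 1 / 2 + 1 = m + 1 / 2 by ring, sub_add_cancel] at e
  have h2 : 0 ≤ m ^ 2 - 1 / 8 := by nlinarith
  rw [e, abs_neg, abs_of_nonneg (by positivity), div_le_div_iff₀ (by positivity) (by positivity)]
  have h3 : (m + 1 / 2) * (m - 1 / 2) = m ^ 2 - 1 / 4 := by ring
  rw [h3]
  have h4 : 3 / 4 * m ^ 2 ≤ m ^ 2 - 1 / 4 := by nlinarith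
  have h5 : (3 / 4 * m ^ 2) ^ 2 ≤ (m ^ 2 - 1 / 4) ^ 2 := by gcongr
  have h6 : 0 ≤ m ^ 3 := by positivity
  have h7 : 0 ≤ m ^ 5 := by positivity
  calc (m ^ 2 - 1 / 8) * m ^ 5 ≤ m ^ 2 * m ^ 5 := by gcongr; linarith
    _ = m ^ 3 * m ^ 4 := by ring
    _ ≤ 2 * (m ^ 3 * (3 / 4 * m ^ 2) ^ 2) := by nlinarith [mul_nonneg h6 (by positivity : 0 ≤ m ^ 4)]
    _ ≤ _ := by gcongr

lemma abs_log_half_sub_le {m : ℝ} (hm : 1 ≤ m) :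
    |Real.log (m + 1 / 2) - Real.log m - 1 / (2 * m) + 1 / (8 * m ^ 2) - 1 / (24 * m ^ 3)|
      ≤ 1 / m ^ 4 := by
  have h := abs_le_mul_pow_succ_of_deriv (L := 1 / 2) (p := 3) (K := 1) (by norm_num)
    (g := fun t => Real.log (1 + t) - t + 1 / 2 * t ^ 2 - 1 / 3 * t ^ 3)
    (g' := fun t => -(t ^ 3 / (1 + t))) (fun t ht => by
      have h1 : 1 + t ≠ 0 := by linarith [ht.1]
      have hid := hasDerivAt_id t
      convert! ((((hid.const_add 1).log h1).sub hid).add ((hid.pow 2).const_mul (1 / 2))).sub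
        ((hid.pow 3).const_mul (1 / 3)) using 1
      simp only [id_eq]
      push_cast
      field_simp
      ring)
    (by simp) (fun t ht => by
      have h1 := ht.1
      rw [abs_neg, abs_of_nonneg (by positivity), one_mul]
      exact div_le_self (by positivity) (by linarith))
    (1 / (2 * m)) ⟨by positivity, by
      rw [div_le_div_iff₀ (by positivity) (by norm_num)]
      linarith⟩
  have e1 : Real.log (m + 1 / 2) = Real.log m + Real.log (1 + 1 / (2 * m)) := by
    rw [← Real.log_mul (by positivity) (by positivity)]
    congr 1
    field_simp
  have e3 : Real.log (m + 1 / 2) - Real.log m - 1 / (2 * m) + 1 / (8 * m ^ 2) - 1 / (24 * m ^ 3)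
      = Real.log (1 + 1 / (2 * m)) - 1 / (2 * m) + 1 / 2 * (1 / (2 * m)) ^ 2
        - 1 / 3 * (1 / (2 * m)) ^ 3 := by
    rw [e1]
    field_simp
    ring
  rw [e3]
  refine h.trans ?_
  rw [show (1 : ℝ) * (1 / (2 * m)) ^ (3 + 1) = 1 / 16 * (1 / m ^ 4) by ring]
  have : 0 ≤ 1 / m ^ 4 := by positivity
  linarith

lemma abs_inv_sq_half_sub_le {m : ℝ} (hm : 1 ≤ m) :
    |1 / (m + 1 / 2) ^ 2 - 1 / m ^ 2 + 1 / m ^ 3| ≤ 1 / m ^ 4 := by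
  have e : 1 / (m + 1 / 2) ^ 2 - 1 / m ^ 2 + 1 / m ^ 3
      = (3 / 4 * m + 1 / 4) / (m ^ 3 * (m + 1 / 2) ^ 2) := by
    field_simp
    ring
  rw [e, abs_of_nonneg (by positivity), div_le_div_iff₀ (by positivity) (by positivity)]
  have h1 : m ^ 2 ≤ (m + 1 / 2) ^ 2 := by nlinarith
  calc (3 / 4 * m + 1 / 4) * m ^ 4 ≤ m * m ^ 4 := by gcongr; linarith
    _ = 1 * (m ^ 3 * m ^ 2) := by ring
    _ ≤ _ := by gcongr

/-- A null sequence whose increments are `O(n⁻⁵)` is `O(n⁻⁴)`. -/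
lemma abs_le_div_pow_four_of_increments {u : ℕ → ℝ} {C : ℝ} (hC : 0 ≤ C)
    (hu : Tendsto u atTop (𝓝 0)) (h : ∀ i : ℕ, 1 ≤ i → |u (i + 1) - u i| ≤ C / ((i : ℝ) + 1) ^ 5)
    {M : ℕ} (hM : 1 ≤ M) : |u M| ≤ C / (M : ℝ) ^ 4 := by
  have hlim := (hu.sub_const (u M)).abs
  rw [zero_sub, abs_neg] at hlim
  refine le_of_tendsto hlim ?_
  filter_upwards [eventually_ge_atTop M] with K hK
  rw [← Finset.sum_Ico_sub u hK]
  refine (Finset.abs_sum_le_sum_abs _ _).trans ?_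
  have hterm : ∀ i ∈ Finset.Ico M K, |u (i + 1) - u i|
      ≤ (-(C / ((i + 1 : ℕ) : ℝ) ^ 4)) - (-(C / (i : ℝ) ^ 4)) := by
    intro i hi
    have hi1 : 1 ≤ i := hM.trans (Finset.mem_Ico.1 hi).1
    have hi0 : (0 : ℝ) < i := by exact_mod_cast hi1
    refine (h i hi1).trans ?_
    -- The fifth powers are dominated by increments of fourth powers, which telescope.
    have : 1 / ((i : ℝ) + 1) ^ 5 ≤ 1 / (i : ℝ) ^ 4 - 1 / ((i : ℝ) + 1) ^ 4 := by
      rw [div_sub_div _ _ (by positivity) (by positivity),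
        div_le_div_iff₀ (by positivity) (by positivity)]
      have e : (1 * ((i : ℝ) + 1) ^ 4 - (i : ℝ) ^ 4 * 1) * ((i : ℝ) + 1) ^ 5
          - 1 * ((i : ℝ) ^ 4 * ((i : ℝ) + 1) ^ 4)
          = ((i : ℝ) + 1) ^ 4 * ((((i : ℝ) + 1) ^ 4 - (i : ℝ) ^ 4) * (i + 1) - (i : ℝ) ^ 4) := by
        ring
      have e2 : (((i : ℝ) + 1) ^ 4 - (i : ℝ) ^ 4) * (i + 1) - (i : ℝ) ^ 4
          = 3 * (i : ℝ) ^ 4 + 10 * (i : ℝ) ^ 3 + 10 * (i : ℝ) ^ 2 + 5 * i + 1 := by ring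
      have : 0 ≤ ((i : ℝ) + 1) ^ 4 * ((((i : ℝ) + 1) ^ 4 - (i : ℝ) ^ 4) * (i + 1) - (i : ℝ) ^ 4) := by
        rw [e2]
        positivity
      linarith
    have h2 := mul_le_mul_of_nonneg_left this hC
    push_cast
    calc C / ((i : ℝ) + 1) ^ 5 = C * (1 / ((i : ℝ) + 1) ^ 5) := by ring
      _ ≤ _ := h2
      _ = _ := by ring
  refine (Finset.sum_le_sum hterm).trans ?_
  rw [Finset.sum_Ico_sub (fun i : ℕ => -(C / (i : ℝ) ^ 4)) hK]
  have : 0 ≤ C / (K : ℝ) ^ 4 := by positivity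
  linarith

end Expansions

/-! ### Shells, and the expansions for closed and half-open squares. -/

section Shells

/-- The sum of the reciprocal quadratic form over the boundary of the square `[-m, m] ^ 2`. -/
noncomputable def shellSum (a b c : ℝ) (m : ℕ) : ℝ :=
  2 * ∑ k ∈ Finset.Icc (-(m : ℤ)) m, recQuad c b a k m
    + 2 * ∑ j ∈ Finset.Icc (-(m : ℤ)) m, recQuad a b c j m
    - 2 * (recQuad a b c m m + recQuad a b c m (-m))

lemma boxSum_succ (a b c : ℝ) (M : ℕ) :
    boxSum a b c (M + 1) = boxSum a b c M + shellSum a b c (M + 1) := by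
  have hs : ∀ g : ℤ → ℝ, ∑ k ∈ Finset.Icc (-((M + 1 : ℕ) : ℤ)) ((M + 1 : ℕ) : ℤ), g k
      = ∑ k ∈ Finset.Icc (-(M : ℤ)) M, g k + g (M + 1) + g (-(M + 1)) := fun g => by
    rw [sum_Icc_neg_eq, sum_Icc_neg_eq, Finset.sum_range_succ]
    ring
  have hrow : ∑ k ∈ Finset.Icc (-((M + 1 : ℕ) : ℤ)) ((M + 1 : ℕ) : ℤ), recQuad a b c (-(M + 1)) k
      = ∑ k ∈ Finset.Icc (-((M + 1 : ℕ) : ℤ)) ((M + 1 : ℕ) : ℤ), recQuad a b c (M + 1) k := by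
    rw [← sum_Icc_neg_comp_neg]
    simp only [recQuad_neg_neg]
  have hcol : ∑ j ∈ Finset.Icc (-(M : ℤ)) M, recQuad a b c j (-(M + 1))
      = ∑ j ∈ Finset.Icc (-(M : ℤ)) M, recQuad a b c j (M + 1) := by
    rw [← sum_Icc_neg_comp_neg]
    simp only [recQuad_neg_neg]
  have hedge := hs fun j => recQuad a b c j (M + 1)
  have hcorner : recQuad a b c (-(M + 1)) (M + 1) = recQuad a b c (M + 1) (-(M + 1)) := by
    rw [← recQuad_neg_neg, neg_neg]
  rw [boxSum, hs fun j => ∑ k ∈ Finset.Icc (-((M + 1 : ℕ) : ℤ)) ((M + 1 : ℕ) : ℤ), recQuad a b c j k,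
    hrow, Finset.sum_congr rfl fun j _ => hs (recQuad a b c j), Finset.sum_add_distrib,
    Finset.sum_add_distrib, hcol, shellSum, boxSum]
  simp only [← recQuad_comm a b c]
  push_cast at hedge ⊢
  rw [hedge, hcorner]
  ring

/-- The sides `j = M` and `k = M` are dropped. By symmetry this is half the shell, except that both
corners `(M, -M)` and `(-M, M)` are dropped instead of one; hence the extra term. -/
lemma sum_Ico_eq_boxSum_sub (a b c : ℝ) (M : ℕ) :
    ∑ j ∈ Finset.Ico (-(M : ℤ)) M, ∑ k ∈ Finset.Ico (-(M : ℤ)) M, recQuad a b c j k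
      = boxSum a b c M - shellSum a b c M / 2 - recQuad a b c M (-M) := by
  have hs : ∀ g : ℤ → ℝ, ∑ k ∈ Finset.Icc (-(M : ℤ)) M, g k
      = ∑ k ∈ Finset.Ico (-(M : ℤ)) M, g k + g M := fun g => by
    rw [← Finset.Ico_insert_right (by omega : (-(M : ℤ)) ≤ M), Finset.sum_insert (by simp), add_comm]
  have hedge := hs fun j => recQuad a b c j M
  rw [boxSum, hs fun j => ∑ k ∈ Finset.Icc (-(M : ℤ)) M, recQuad a b c j k,
    Finset.sum_congr rfl fun j _ => hs (recQuad a b c j), Finset.sum_add_distrib, shellSum]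
  simp only [← recQuad_comm a b c]
  rw [hedge]
  ring

variable {a b c δ : ℝ}

/-- The trapezoidal rule for the kernel on `[-1, 1]`, divided by `m`: the endpoint average gives the
`m⁻²` term, the integral `m⁻¹`, the derivative correction `m⁻³`. -/
lemma exists_edge_bound (ha : 0 < a) (hδ : 0 < δ) (hd : δ ^ 2 = 4 * a * c - b ^ 2) :
    ∃ C, 0 ≤ C ∧ ∀ m : ℕ, 1 ≤ m →
      |∑ j ∈ Finset.Icc (-(m : ℤ)) m, recQuad a b c j m
        - (1 / (a - b + c) + 1 / (a + b + c)) / (2 * (m : ℝ) ^ 2)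
        - 2 / δ * (Real.pi / 2 - Real.arctan ((c - a) / δ)) / m
        - ((b - 2 * a) / (a - b + c) ^ 2 - (b + 2 * a) / (a + b + c) ^ 2) / (12 * (m : ℝ) ^ 3)|
        ≤ C / (m : ℝ) ^ 5 := by
  have hsm := contDiff_kern ha hδ hd
  have hD : ∀ n : ℕ, ∀ u, HasDerivAt (iteratedDeriv n (kern a b c))
      (iteratedDeriv (n + 1) (kern a b c) u) u := fun n u => by
    rw [iteratedDeriv_succ]
    exact ((hsm.differentiable_iteratedDeriv n (WithTop.coe_lt_top _)) u).hasDerivAt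
  obtain ⟨K, hK⟩ := exists_bound_on_Icc (hsm.continuous_iteratedDeriv 4 le_top)
  have hK0 : 0 ≤ K := (abs_nonneg _).trans (hK 0 (by norm_num))
  refine ⟨2 * K, by positivity, fun m hm => ?_⟩
  have hm0 : (0 : ℝ) < m := by exact_mod_cast hm
  have hd0 := hD 0
  rw [iteratedDeriv_zero] at hd0
  have h := trapezoid_sum (hasDerivAt_kernInt ha hδ hd) hd0 (hD 1) (hD 2) (hD 3) hK hm
  have e1 : iteratedDeriv (0 + 1) (kern a b c) 1 = -(b + 2 * a) / (a + b + c) ^ 2 := by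
    rw [(hd0 1).unique (hasDerivAt_kern ha hδ hd 1)]
    ring
  have e2 : iteratedDeriv (0 + 1) (kern a b c) (-1) = -(b - 2 * a) / (a - b + c) ^ 2 := by
    rw [(hd0 (-1)).unique (hasDerivAt_kern ha hδ hd (-1))]
    ring
  have e3 : kernInt a b δ 1 - kernInt a b δ (-1)
      = 2 / δ * (Real.pi / 2 - Real.arctan ((c - a) / δ)) := by
    rw [← angle_one_sub_angle_neg_one ha hδ hd, kernInt, kernInt]
    ring
  have e4 : kern a b c (-1) = 1 / (a - b + c) := by
    rw [kern]
    congr 1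
    ring
  have e5 : kern a b c 1 = 1 / (a + b + c) := by
    rw [kern]
    congr 1
    ring
  rw [e1, e2, e3, e4, e5] at h
  have hsum : ∑ j ∈ Finset.Icc (-(m : ℤ)) m, recQuad a b c j m
      = 1 / m * (1 / m * ∑ j ∈ Finset.Icc (-(m : ℤ)) m, kern a b c ((j : ℝ) / m)) := by
    rw [Finset.sum_congr rfl fun j _ => recQuad_eq_kern a b c j (by omega : m ≠ 0),
      ← Finset.mul_sum, ← Finset.mul_sum]
  have hfin := mul_le_mul_of_nonneg_left h (by positivity : (0 : ℝ) ≤ 1 / m)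
  rw [← abs_of_pos (by positivity : (0 : ℝ) < 1 / m), ← abs_mul,
    abs_of_pos (by positivity : (0 : ℝ) < 1 / m)] at hfin
  rw [hsum]
  convert! hfin using 1
  · congr 1
    generalize 1 / (a - b + c) = q
    generalize 1 / (a + b + c) = p
    rw [neg_div, neg_div]
    generalize (b - 2 * a) / (a - b + c) ^ 2 = q'
    generalize (b + 2 * a) / (a + b + c) ^ 2 = p'
    field_simp
    ring
  · field_simp

/-- Horizontal and vertical edges differ by exchanging `a` and `c`. In their sum the arctangents
cancel and leave `π`; the endpoint averages cancel against the doubly counted corners; and the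
numerators `(b - 2a) + (b - 2c)` and `(b + 2a) + (b + 2c)` each cancel one power of their
denominators. -/
lemma exists_shell_bound (ha : 0 < a) (hc : 0 < c) (hδ : 0 < δ)
    (hd : δ ^ 2 = 4 * a * c - b ^ 2) :
    ∃ C, 0 ≤ C ∧ ∀ m : ℕ, 1 ≤ m →
      |shellSum a b c m - 4 * Real.pi / δ / m
        + (1 / (a - b + c) + 1 / (a + b + c)) / (3 * (m : ℝ) ^ 3)| ≤ C / (m : ℝ) ^ 5 := by
  have hd' : δ ^ 2 = 4 * c * a - b ^ 2 := by rw [hd]; ring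
  obtain ⟨C, hC0, hC⟩ := exists_edge_bound ha hδ hd
  obtain ⟨C', hC0', hC'⟩ := exists_edge_bound hc hδ hd'
  refine ⟨2 * C + 2 * C', by positivity, fun m hm => ?_⟩
  have hm0 : (0 : ℝ) < m := by exact_mod_cast hm
  have h1 := hC m hm
  have h2 := hC' m hm
  have hq : 0 < a - b + c := by linarith [quad_pos ha hδ hd (-1)]
  have hp : 0 < a + b + c := by linarith [quad_pos ha hδ hd 1]
  have hmm : recQuad a b c m m = 1 / (a + b + c) / (m : ℝ) ^ 2 := by
    rw [recQuad]
    push_cast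
    rw [div_div]
    congr 1
    ring
  have hmn : recQuad a b c m (-m) = 1 / (a - b + c) / (m : ℝ) ^ 2 := by
    rw [recQuad]
    push_cast
    rw [div_div]
    congr 1
    ring
  have harc : Real.arctan ((a - c) / δ) = -Real.arctan ((c - a) / δ) := by
    rw [← Real.arctan_neg]
    congr 1
    ring
  rw [harc, show c - b + a = a - b + c by ring, show c + b + a = a + b + c by ring] at h2
  have key : shellSum a b c m - 4 * Real.pi / δ / m
        + (1 / (a - b + c) + 1 / (a + b + c)) / (3 * (m : ℝ) ^ 3)
      = 2 * (∑ j ∈ Finset.Icc (-(m : ℤ)) m, recQuad a b c j m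
        - (1 / (a - b + c) + 1 / (a + b + c)) / (2 * (m : ℝ) ^ 2)
        - 2 / δ * (Real.pi / 2 - Real.arctan ((c - a) / δ)) / m
        - ((b - 2 * a) / (a - b + c) ^ 2 - (b + 2 * a) / (a + b + c) ^ 2) / (12 * (m : ℝ) ^ 3))
      + 2 * (∑ j ∈ Finset.Icc (-(m : ℤ)) m, recQuad c b a j m
        - (1 / (a - b + c) + 1 / (a + b + c)) / (2 * (m : ℝ) ^ 2)
        - 2 / δ * (Real.pi / 2 - -Real.arctan ((c - a) / δ)) / m
        - ((b - 2 * c) / (a - b + c) ^ 2 - (b + 2 * c) / (a + b + c) ^ 2) / (12 * (m : ℝ) ^ 3)) := by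
    rw [shellSum, hmm, hmn]
    generalize ∑ j ∈ Finset.Icc (-(m : ℤ)) m, recQuad a b c j m = W
    generalize ∑ j ∈ Finset.Icc (-(m : ℤ)) m, recQuad c b a j m = U
    generalize Real.arctan ((c - a) / δ) = θ
    field_simp
    ring
  rw [key]
  calc _ ≤ _ := abs_add_le _ _
    _ ≤ 2 * (C / (m : ℝ) ^ 5) + 2 * (C' / (m : ℝ) ^ 5) := by
      rw [abs_mul, abs_mul, abs_two]
      gcongr
    _ = _ := by ring

/-- Asymptotic expansion of the sums over the squares `[-M, M] ^ 2`. -/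
theorem exists_boxSum_bound (ha : 0 < a) (hc : 0 < c) (hδ : 0 < δ)
    (hd : δ ^ 2 = 4 * a * c - b ^ 2) {κ₀ : ℝ}
    (hκ : Tendsto (fun M : ℕ => boxSum a b c M - 4 * Real.pi / δ * Real.log M) atTop (𝓝 κ₀)) :
    ∃ C, 0 ≤ C ∧ ∀ M : ℕ, 1 ≤ M →
      |boxSum a b c M - (4 * Real.pi / δ * Real.log (M + 1 / 2) + κ₀
        + (Real.pi / (6 * δ) + (1 / (a - b + c) + 1 / (a + b + c)) / 6) / ((M : ℝ) + 1 / 2) ^ 2)|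
        ≤ C / (M : ℝ) ^ 4 := by
  obtain ⟨C, hC0, hC⟩ := exists_shell_bound ha hc hδ hd
  set r := 1 / (a - b + c) + 1 / (a + b + c) with hr
  -- Chosen so that the `m⁻³` terms of the increments cancel: `4π / (12δ) + r / 3 = 2κ`.
  set κ := Real.pi / (6 * δ) + r / 6 with hκ'
  have hpi := Real.pi_pos
  refine ⟨C + 4 * Real.pi / δ + |κ| * 2, by positivity, fun M hM => ?_⟩
  refine abs_le_div_pow_four_of_increments (u := fun M : ℕ => boxSum a b c M
    - (4 * Real.pi / δ * Real.log (M + 1 / 2) + κ₀ + κ / ((M : ℝ) + 1 / 2) ^ 2))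
    (by positivity) ?_ ?_ hM
  · have h1 : Tendsto (fun M : ℕ => Real.log ((M : ℝ) + 1 / 2) - Real.log M) atTop (𝓝 0) :=
      (Real.tendsto_log_comp_add_sub_log (1 / 2)).comp tendsto_natCast_atTop_atTop
    have h2 : Tendsto (fun M : ℕ => κ / ((M : ℝ) + 1 / 2) ^ 2) atTop (𝓝 0) := by
      refine tendsto_const_nhds.div_atTop ?_
      exact (tendsto_pow_atTop two_ne_zero).comp
        (tendsto_natCast_atTop_atTop.atTop_add tendsto_const_nhds)
    have h3 := ((hκ.sub (h1.const_mul (4 * Real.pi / δ))).sub_const κ₀).sub h2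
    simp only [mul_zero, sub_zero, sub_self] at h3
    refine h3.congr fun M => ?_
    ring
  · intro i _
    have hm : (1 : ℝ) ≤ (i : ℝ) + 1 := by linarith [(Nat.cast_nonneg i : (0 : ℝ) ≤ i)]
    have s1 := hC (i + 1) (by omega)
    have s2 := abs_log_div_sub_le hm
    have s3 := abs_inv_sq_sub_le hm
    push_cast at s1
    rw [show (i : ℝ) + 1 - 1 / 2 = i + 1 / 2 by ring] at s2 s3
    rw [boxSum_succ]
    push_cast
    set m : ℝ := (i : ℝ) + 1 with hmdef
    have hm0 : 0 < m := by linarith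
    have key : boxSum a b c i + shellSum a b c (i + 1)
          - (4 * Real.pi / δ * Real.log (m + 1 / 2) + κ₀ + κ / (m + 1 / 2) ^ 2)
          - (boxSum a b c i - (4 * Real.pi / δ * Real.log (i + 1 / 2) + κ₀
            + κ / ((i : ℝ) + 1 / 2) ^ 2))
        = (shellSum a b c (i + 1) - 4 * Real.pi / δ / m + r / (3 * m ^ 3))
          - 4 * Real.pi / δ * (Real.log (m + 1 / 2) - Real.log (i + 1 / 2) - 1 / m
            - 1 / (12 * m ^ 3))
          - κ * (1 / (m + 1 / 2) ^ 2 - 1 / ((i : ℝ) + 1 / 2) ^ 2 + 2 / m ^ 3) := by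
      have : 4 * Real.pi / δ * (1 / (12 * m ^ 3)) + r / (3 * m ^ 3) = κ * (2 / m ^ 3) := by
        rw [hκ']
        field_simp
        ring
      linear_combination (-1 : ℝ) * this
    rw [key]
    calc _ ≤ |shellSum a b c (i + 1) - 4 * Real.pi / δ / m + r / (3 * m ^ 3)|
          + |4 * Real.pi / δ * (Real.log (m + 1 / 2) - Real.log (i + 1 / 2) - 1 / m
            - 1 / (12 * m ^ 3))|
          + |κ * (1 / (m + 1 / 2) ^ 2 - 1 / ((i : ℝ) + 1 / 2) ^ 2 + 2 / m ^ 3)| :=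
        (abs_sub _ _).trans (add_le_add_left (abs_sub _ _) _)
      _ ≤ C / m ^ 5 + 4 * Real.pi / δ * (1 / m ^ 5) + |κ| * (2 / m ^ 5) := by
        rw [abs_mul, abs_mul, abs_of_pos (by positivity : 0 < 4 * Real.pi / δ)]
        gcongr
      _ = _ := by ring

/-- Asymptotic expansion of the sums over the half-open squares `[-M, M) ^ 2`. -/
theorem exists_sum_Ico_bound (ha : 0 < a) (hc : 0 < c) (hδ : 0 < δ)
    (hd : δ ^ 2 = 4 * a * c - b ^ 2) {κ₀ : ℝ}
    (hκ : Tendsto (fun M : ℕ => boxSum a b c M - 4 * Real.pi / δ * Real.log M) atTop (𝓝 κ₀)) :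
    ∃ C, 0 ≤ C ∧ ∀ M : ℕ, 1 ≤ M →
      |∑ j ∈ Finset.Ico (-(M : ℤ)) M, ∑ k ∈ Finset.Ico (-(M : ℤ)) M, recQuad a b c j k
        - (4 * Real.pi / δ * Real.log M + κ₀
          + (-Real.pi / (3 * δ) + (1 / (a - b + c) + 1 / (a + b + c)) / 6 - 1 / (a - b + c))
            / (M : ℝ) ^ 2)|
        ≤ C / (M : ℝ) ^ 4 := by
  obtain ⟨C, hC0, hC⟩ := exists_boxSum_bound ha hc hδ hd hκ
  obtain ⟨C', hC0', hC'⟩ := exists_shell_bound ha hc hδ hd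
  set r := 1 / (a - b + c) + 1 / (a + b + c) with hr
  set κ := Real.pi / (6 * δ) + r / 6 with hκ'
  have hpi := Real.pi_pos
  refine ⟨C + C' + 4 * Real.pi / δ + |κ|, by positivity, fun M hM => ?_⟩
  have hm : (1 : ℝ) ≤ M := by exact_mod_cast hM
  have s0 := hC M hM
  have s1 := hC' M hM
  have s2 := abs_log_half_sub_le hm
  have s3 := abs_inv_sq_half_sub_le hm
  have hmn : recQuad a b c M (-M) = 1 / (a - b + c) / (M : ℝ) ^ 2 := by
    rw [recQuad]
    push_cast
    rw [div_div]
    congr 1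
    ring
  rw [sum_Ico_eq_boxSum_sub, hmn]
  set m : ℝ := (M : ℝ)
  have hm0 : 0 < m := by linarith
  have s1' : |shellSum a b c M - 4 * Real.pi / δ / m + r / (3 * m ^ 3)| ≤ C' / m ^ 4 := by
    refine s1.trans ?_
    gcongr
    norm_num
  generalize 1 / (a - b + c) = q at *
  have key : boxSum a b c M - shellSum a b c M / 2 - q / m ^ 2
        - (4 * Real.pi / δ * Real.log m + κ₀ + (-Real.pi / (3 * δ) + r / 6 - q) / m ^ 2)
      = (boxSum a b c M - (4 * Real.pi / δ * Real.log (m + 1 / 2) + κ₀ + κ / (m + 1 / 2) ^ 2))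
        - 1 / 2 * (shellSum a b c M - 4 * Real.pi / δ / m + r / (3 * m ^ 3))
        + 4 * Real.pi / δ * (Real.log (m + 1 / 2) - Real.log m - 1 / (2 * m) + 1 / (8 * m ^ 2)
          - 1 / (24 * m ^ 3))
        + κ * (1 / (m + 1 / 2) ^ 2 - 1 / m ^ 2 + 1 / m ^ 3) := by
    -- Re-expanding at `M` instead of `M + 1/2`, the `m⁻¹` and `m⁻³` terms cancel against half the
    -- shell; the term `-1 / (8m²)` of the logarithm turns `π / (6δ)` into `-π / (3δ)`.
    have e1 : 4 * Real.pi / δ * (1 / (24 * m ^ 3)) + r / (6 * m ^ 3) = κ * (1 / m ^ 3) := by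
      rw [hκ']
      field_simp
      ring
    have e2 : -Real.pi / (3 * δ) + r / 6 = κ - 4 * Real.pi / δ / 8 := by
      rw [hκ']
      field_simp
      ring
    rw [e2]
    linear_combination (-1 : ℝ) * e1
  rw [key]
  calc _ ≤ |boxSum a b c M - (4 * Real.pi / δ * Real.log (m + 1 / 2) + κ₀ + κ / (m + 1 / 2) ^ 2)|
        + |1 / 2 * (shellSum a b c M - 4 * Real.pi / δ / m + r / (3 * m ^ 3))|
        + |4 * Real.pi / δ * (Real.log (m + 1 / 2) - Real.log m - 1 / (2 * m) + 1 / (8 * m ^ 2)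
          - 1 / (24 * m ^ 3))|
        + |κ * (1 / (m + 1 / 2) ^ 2 - 1 / m ^ 2 + 1 / m ^ 3)| :=
      (abs_add_le _ _).trans (add_le_add_left ((abs_add_le _ _).trans
        (add_le_add_left (abs_sub _ _) _)) _)
    _ ≤ C / m ^ 4 + 1 / 2 * (C' / m ^ 4) + 4 * Real.pi / δ * (1 / m ^ 4) + |κ| * (1 / m ^ 4) := by
      rw [abs_mul, abs_mul, abs_mul, abs_of_pos (by positivity : 0 < 4 * Real.pi / δ),
        abs_of_pos (by norm_num : (0 : ℝ) < 1 / 2)]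
      gcongr
    _ ≤ C / m ^ 4 + 1 * (C' / m ^ 4) + 4 * Real.pi / δ * (1 / m ^ 4) + |κ| * (1 / m ^ 4) := by
      gcongr
      norm_num
    _ = _ := by ring

end Shells

/-! ### The index set of the sum. -/

section Grid

lemma t_mem_Ico_iff {n : ℕ} (hn : 1 ≤ n) (j : ℤ) :
    t n j ∈ Set.Ico (-Real.pi) Real.pi ↔ -(n : ℤ) ≤ 2 * j ∧ 2 * j < n := by
  have hn0 : (0 : ℝ) < n := by exact_mod_cast hn
  have hpi := Real.pi_pos
  rw [Set.mem_Ico, t, le_div_iff₀ hn0, div_lt_iff₀ hn0]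
  have e1 : -(n : ℤ) ≤ 2 * j ↔ -(n : ℝ) ≤ 2 * j := by exact_mod_cast Iff.rfl
  have e2 : 2 * j < (n : ℤ) ↔ 2 * (j : ℝ) < n := by exact_mod_cast Iff.rfl
  rw [e1, e2, show -Real.pi * n = Real.pi * -(n : ℝ) by ring,
    show 2 * Real.pi * j = Real.pi * (2 * (j : ℝ)) by ring, mul_le_mul_iff_right₀ hpi,
    mul_lt_mul_iff_right₀ hpi]

lemma t_mem_Icc_iff {n : ℕ} (hn : 1 ≤ n) (i j : ℤ) :
    t n i ∈ Set.Icc (x n j) (x n (j + 1)) ↔ i = j := by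
  have hn0 : (0 : ℝ) < n := by exact_mod_cast hn
  have hpi := Real.pi_pos
  have e1 : x n j = Real.pi / n * (2 * j - 1) := by
    rw [x, t]
    ring
  have e2 : x n (j + 1) = Real.pi / n * (2 * j + 1) := by
    rw [x, t]
    push_cast
    ring
  have e3 : t n i = Real.pi / n * (2 * i) := by
    rw [t]
    ring
  rw [Set.mem_Icc, e1, e2, e3, mul_le_mul_iff_right₀ (by positivity),
    mul_le_mul_iff_right₀ (by positivity)]
  have c1 : (2 * j - 1 : ℝ) ≤ 2 * i ↔ 2 * j - 1 ≤ 2 * i := by exact_mod_cast Iff.rfl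
  have c2 : (2 * i : ℝ) ≤ 2 * j + 1 ↔ 2 * i ≤ 2 * j + 1 := by exact_mod_cast Iff.rfl
  rw [c1, c2]
  omega

lemma tt_eq_zero_iff {n : ℕ} (hn : 1 ≤ n) (p : ℤ × ℤ) : tt n p = 0 ↔ p = 0 := by
  have hn0 : (n : ℝ) ≠ 0 := by positivity
  simp [tt, t, Prod.ext_iff, hn0, Real.pi_ne_zero]

/-- A closed cell reaches only half a grid step from its centre, so the centre is its only grid
point and the union of cells adds none. -/
lemma tt_mem_D_iff {n : ℕ} (hn : 1 ≤ n) (p : ℤ × ℤ) :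
    tt n p ∈ D n ↔ ((-(n : ℤ) ≤ 2 * p.1 ∧ 2 * p.1 < n) ∧ (-(n : ℤ) ≤ 2 * p.2 ∧ 2 * p.2 < n))
      ∧ p ≠ 0 := by
  have hcell : ∀ q : ℤ × ℤ, tt n p ∈ cell n q ↔ p = q := fun q => by
    rw [cell, Set.mem_prod, tt, t_mem_Icc_iff hn, t_mem_Icc_iff hn, Prod.ext_iff]
  simp only [D, Set.mem_iUnion, hcell, exists_prop, exists_eq_right', Set.mem_ofPred_eq,
    Set.mem_sdiff, Set.mem_singleton_iff, tt_eq_zero_iff hn, Set.mem_prod]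
  simp only [tt, t_mem_Ico_iff hn, ne_eq]

/-- With `g 0 = 0` the origin may be included, which makes the index set a product. For `f_1` this
holds because `1 / 0 = 0`. -/
lemma F_eq_sum {n : ℕ} (hn : 1 ≤ n) {J : Finset ℤ}
    (hJ : ∀ j, j ∈ J ↔ -(n : ℤ) ≤ 2 * j ∧ 2 * j < n) {g : ℝ × ℝ → ℝ} (hg : g 0 = 0) :
    F n g = ∑ j ∈ J, ∑ k ∈ J, g (tt n (j, k)) := by
  have hset : {p : ℤ × ℤ | tt n p ∈ D n} = ((J ×ˢ J).erase 0 : Finset (ℤ × ℤ)) := by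
    ext p
    simp only [Set.mem_ofPred_eq, tt_mem_D_iff hn, Finset.coe_erase, Set.mem_sdiff, Finset.mem_coe,
      Finset.mem_product, hJ, Set.mem_singleton_iff, ne_eq]
  rw [F, hset, finsum_mem_coe_finset, Finset.sum_erase, Finset.sum_product]
  rw [(tt_eq_zero_iff hn 0).2 rfl, hg]

end Grid

/-! ### The quadratic form attached to the vectors. -/

section Form

variable {V ι : Type*} [AddCommGroup V] [Module ℝ V] [Fintype ι]

lemma sum_sq_eq (B : Module.Basis (Fin 2) ℝ V) (v : ι → V) (y z : ℝ) :
    ∑ ℓ, (s B v 0 ℓ * y + s B v 1 ℓ * z) ^ 2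
      = coeffA B v * y ^ 2 + coeffB B v * y * z + coeffC B v * z ^ 2 := by
  have : ∀ ℓ, (s B v 0 ℓ * y + s B v 1 ℓ * z) ^ 2 = s B v 0 ℓ ^ 2 * y ^ 2
      + 2 * y * z * (s B v 0 ℓ * s B v 1 ℓ) + s B v 1 ℓ ^ 2 * z ^ 2 := fun ℓ => by ring
  simp only [this, Finset.sum_add_distrib, ← Finset.sum_mul, ← Finset.mul_sum, coeffA, coeffB,
    coeffC]
  ring

/-- Both basis vectors occur among the `v ℓ`, and their coordinates `(1, 0)` and `(0, 1)` contribute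
`y²` and `z²` to the sum of squares. -/
lemma form_pos {B : Module.Basis (Fin 2) ℝ V} {v : ι → V} (hB : ∀ i, B i ∈ Set.range v)
    {y z : ℝ} (h : y ≠ 0 ∨ z ≠ 0) :
    0 < coeffA B v * y ^ 2 + coeffB B v * y * z + coeffC B v * z ^ 2 := by
  rw [← sum_sq_eq]
  obtain ⟨i, hi⟩ := hB 0
  obtain ⟨k, hk⟩ := hB 1
  have hnn : ∀ ℓ ∈ Finset.univ, 0 ≤ (s B v 0 ℓ * y + s B v 1 ℓ * z) ^ 2 :=
    fun ℓ _ => sq_nonneg _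
  have e1 : s B v 0 i * y + s B v 1 i * z = y := by simp [s, hi]
  have e2 : s B v 0 k * y + s B v 1 k * z = z := by simp [s, hk]
  rcases h with h | h
  · refine lt_of_lt_of_le ?_ (Finset.single_le_sum hnn (Finset.mem_univ i))
    rw [e1]
    positivity
  · refine lt_of_lt_of_le ?_ (Finset.single_le_sum hnn (Finset.mem_univ k))
    rw [e2]
    positivity

lemma f_one_eq (B : Module.Basis (Fin 2) ℝ V) (v : ι → V) (y : ℝ × ℝ) :
    f B v 1 y = 2 * (Fintype.card ι : ℝ)
      * (1 / (coeffA B v * y.1 ^ 2 + coeffB B v * y.1 * y.2 + coeffC B v * y.2 ^ 2)) := by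
  rw [f, taylorPoly, ← sum_sq_eq]
  simp only [Finset.Icc_self, Finset.sum_singleton]
  norm_num [Nat.factorial]
  rw [← Finset.sum_div, inv_div]
  ring

lemma f_one_tt (B : Module.Basis (Fin 2) ℝ V) (v : ι → V) (n : ℕ) (p : ℤ × ℤ) :
    f B v 1 (tt n p) = (Fintype.card ι : ℝ) * (n : ℝ) ^ 2 / (2 * Real.pi ^ 2)
      * recQuad (coeffA B v) (coeffB B v) (coeffC B v) p.1 p.2 := by
  rw [f_one_eq, recQuad]
  simp only [tt, t]
  have e : coeffA B v * (2 * Real.pi * p.1 / n) ^ 2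
      + coeffB B v * (2 * Real.pi * p.1 / n) * (2 * Real.pi * p.2 / n)
      + coeffC B v * (2 * Real.pi * p.2 / n) ^ 2
      = (4 * Real.pi ^ 2 / (n : ℝ) ^ 2) * (coeffA B v * (p.1 : ℝ) ^ 2
        + coeffB B v * p.1 * p.2 + coeffC B v * (p.2 : ℝ) ^ 2) := by ring
  rw [e, ← one_div_mul_one_div, one_div_div]
  ring

lemma F_f_one_eq (B : Module.Basis (Fin 2) ℝ V) (v : ι → V) {n : ℕ} (hn : 1 ≤ n) {J : Finset ℤ}
    (hJ : ∀ j, j ∈ J ↔ -(n : ℤ) ≤ 2 * j ∧ 2 * j < n) :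
    F n (f B v 1) = (Fintype.card ι : ℝ) * (n : ℝ) ^ 2 / (2 * Real.pi ^ 2)
      * ∑ j ∈ J, ∑ k ∈ J, recQuad (coeffA B v) (coeffB B v) (coeffC B v) j k := by
  rw [F_eq_sum hn hJ (by simp [f_one_eq])]
  simp only [f_one_tt, Finset.mul_sum]

end Form

end LatticeSum

/-! ### The main theorem. -/

open LatticeSum in
theorem theorem4 {V ι : Type*} [AddCommGroup V] [Module ℝ V] [Fintype ι]
    (v : ι → V) (hv : ∀ ℓ, v ℓ ≠ 0)
    (B : Module.Basis (Fin 2) ℝ V) (hB : ∀ i, B i ∈ Set.range v)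
    (hspan : Submodule.span ℤ (Set.range v) = Submodule.span ℤ (Set.range B))
    (a b c d N : ℝ)
    (ha : a = LatticeSum.coeffA B v) (hb : b = LatticeSum.coeffB B v)
    (hc : c = LatticeSum.coeffC B v) (hd : d = LatticeSum.disc a b c)
    (hN : N = (Fintype.card ι : ℝ)) :
    (fun n : ℕ =>
      LatticeSum.F n (LatticeSum.f B v 1) -
        (2 * N / (Real.pi * Real.sqrt |d|) * (n : ℝ) ^ 2 * Real.log n
        + N / (Real.pi ^ 2 * Real.sqrt |d|)
          * (2 * Real.pi * (Real.eulerMascheroniConstant - Real.log 2)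
            - 4 * Real.pi * Real.log ‖ModularForm.eta (LatticeSum.mu a b c)‖
            + (Real.pi / 2 - Real.arctan ((c - a) / Real.sqrt |d|)) * Real.log (c / a)
            - LatticeSum.constC a b c) * (n : ℝ) ^ 2
        + N / Real.pi ^ 2
          * (1 / 3 * (1 / (a - b + c) + 1 / (a + b + c) + Real.pi / Real.sqrt |d|)
            - (1 + (-1 : ℝ) ^ n) / 2 * (Real.pi / Real.sqrt |d| + 2 / (a - b + c)))))
      =O[Filter.atTop] (fun n : ℕ => Real.log n / (n : ℝ) ^ 2) := by
  have hpos : ∀ {y z : ℝ}, (y ≠ 0 ∨ z ≠ 0) → 0 < a * y ^ 2 + b * y * z + c * z ^ 2 := by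
    rw [ha, hb, hc]
    exact fun h => form_pos hB h
  have ha0 : 0 < a := by simpa using hpos (y := 1) (z := 0) (by simp)
  have hc0 : 0 < c := by simpa using hpos (y := 0) (z := 1) (by simp)
  have hdisc : 0 < 4 * a * c - b ^ 2 := by
    -- At the point `(b, -2a)` the form takes the value `a (4 a c - b²)`.
    have h := hpos (y := b) (z := -2 * a) (Or.inr (by simp [ha0.ne']))
    have e : a * b ^ 2 + b * b * (-2 * a) + c * (-2 * a) ^ 2 = a * (4 * a * c - b ^ 2) := by ring
    rw [e] at h
    exact pos_of_mul_pos_right h ha0.le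
  have habs : |disc a b c| = 4 * a * c - b ^ 2 := by
    rw [disc, abs_of_neg (by linarith)]
    ring
  set δ := Real.sqrt |disc a b c| with hδdef
  have hδ : 0 < δ := by
    rw [hδdef, habs]
    exact Real.sqrt_pos.2 hdisc
  have hd2 : δ ^ 2 = 4 * a * c - b ^ 2 := by
    rw [hδdef, Real.sq_sqrt (abs_nonneg _), habs]
  rw [hd, ← hδdef]
  have hlim := tendsto_boxSum_sub_log ha0 hc0 hδ hd2
  rw [logKernInt_one_sub ha0 hδ hd2] at hlim
  have hmu : mu a b c = (-b + δ * Complex.I) / (2 * c) := rfl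
  have hC : constC a b c = clausen (Real.pi - 2 * Real.arctan ((2 * a - b) / δ))
      + clausen (Real.pi - 2 * Real.arctan ((2 * a + b) / δ))
      + clausen (Real.pi - 2 * Real.arctan ((2 * c - b) / δ))
      + clausen (Real.pi - 2 * Real.arctan ((2 * c + b) / δ)) := rfl
  rw [← hmu, ← hC] at hlim
  obtain ⟨C₁, hC₁, hodd⟩ := exists_boxSum_bound ha0 hc0 hδ hd2 hlim
  obtain ⟨C₂, hC₂, heven⟩ := exists_sum_Ico_bound ha0 hc0 hδ hd2 hlim
  generalize Real.log ‖ModularForm.eta (mu a b c)‖ = η at *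
  generalize constC a b c = κ at *
  generalize Real.arctan ((c - a) / δ) = θ at *
  have hN0 : 0 ≤ N := by rw [hN]; positivity
  have hpi := Real.pi_pos
  -- From `n ≤ 3M` the error `C / M⁴` is at most `81 C / n⁴`; the prefactor `N n² / (2π²)` makes it
  -- `O(n⁻²)`, and `log n ≥ 1` for `n ≥ 3` gives the stated form.
  refine Asymptotics.IsBigO.of_bound (N / (2 * Real.pi ^ 2) * (81 * (C₁ + C₂))) ?_
  filter_upwards [Filter.eventually_ge_atTop 3] with n hn
  have hn0 : (0 : ℝ) < n := by positivity
  have hlog : 1 ≤ Real.log n := by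
    rw [Real.le_log_iff_exp_le hn0]
    have : (3 : ℝ) ≤ n := by exact_mod_cast hn
    linarith [Real.exp_one_lt_d9]
  have hlog2 : Real.log ((n : ℝ) / 2) = Real.log n - Real.log 2 :=
    Real.log_div hn0.ne' two_ne_zero
  have hfinal : ∀ {S T C : ℝ} {M : ℕ}, 0 ≤ C → C ≤ C₁ + C₂ → 1 ≤ M → n ≤ 3 * M →
      |S - T| ≤ C / (M : ℝ) ^ 4 →
      ‖N * (n : ℝ) ^ 2 / (2 * Real.pi ^ 2) * S - N * (n : ℝ) ^ 2 / (2 * Real.pi ^ 2) * T‖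
        ≤ N / (2 * Real.pi ^ 2) * (81 * (C₁ + C₂)) * ‖Real.log n / (n : ℝ) ^ 2‖ := by
    intro S T C M hC0 hCC hM hnM h
    have hM0 : (0 : ℝ) < M := by exact_mod_cast hM
    have hnM' : (n : ℝ) ≤ 3 * M := by exact_mod_cast hnM
    have h4 : (n : ℝ) ^ 4 ≤ 81 * (M : ℝ) ^ 4 := by
      calc (n : ℝ) ^ 4 ≤ (3 * M) ^ 4 := by gcongr
        _ = _ := by ring
    have h5 : C / (M : ℝ) ^ 4 ≤ 81 * (C₁ + C₂) / (n : ℝ) ^ 4 := by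
      rw [div_le_div_iff₀ (by positivity) (by positivity)]
      calc C * (n : ℝ) ^ 4 ≤ (C₁ + C₂) * (81 * (M : ℝ) ^ 4) := by gcongr
        _ = _ := by ring
    rw [← mul_sub, norm_mul, Real.norm_of_nonneg (by positivity),
      Real.norm_of_nonneg (by positivity : 0 ≤ Real.log n / (n : ℝ) ^ 2), Real.norm_eq_abs]
    calc N * (n : ℝ) ^ 2 / (2 * Real.pi ^ 2) * |S - T|
        ≤ N * (n : ℝ) ^ 2 / (2 * Real.pi ^ 2) * (81 * (C₁ + C₂) / (n : ℝ) ^ 4) := by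
          gcongr
          exact h.trans h5
      _ = N / (2 * Real.pi ^ 2) * (81 * (C₁ + C₂)) * (1 / (n : ℝ) ^ 2) := by
          field_simp
      _ ≤ _ := by gcongr
  have hF : ∀ {J : Finset ℤ}, (∀ j, j ∈ J ↔ -(n : ℤ) ≤ 2 * j ∧ 2 * j < n) →
      F n (f B v 1) = N * (n : ℝ) ^ 2 / (2 * Real.pi ^ 2)
        * ∑ j ∈ J, ∑ k ∈ J, recQuad a b c j k := by
    intro J hJ
    rw [F_f_one_eq B v (by omega) hJ, ← ha, ← hb, ← hc, ← hN]
  rcases Nat.even_or_odd' n with ⟨M, hM | hM⟩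
  · have hJ : ∀ j : ℤ, j ∈ Finset.Ico (-(M : ℤ)) M ↔ -(n : ℤ) ≤ 2 * j ∧ 2 * j < n := by
      intro j
      rw [Finset.mem_Ico]
      omega
    have hMn : (M : ℝ) = n / 2 := by
      rw [hM]
      push_cast
      ring
    have hsign : (-1 : ℝ) ^ n = 1 := by rw [hM, pow_mul]; norm_num
    have h := heven M (by omega)
    convert! hfinal hC₂ (by linarith) (by omega : 1 ≤ M) (by omega) h using 2
    rw [hF hJ, hsign, hMn, hlog2, show 2 / (a - b + c) = 2 * (1 / (a - b + c)) by ring]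
    generalize 1 / (a - b + c) = q
    generalize 1 / (a + b + c) = p
    congr 1
    field_simp
    ring
  · have hJ : ∀ j : ℤ, j ∈ Finset.Icc (-(M : ℤ)) M ↔ -(n : ℤ) ≤ 2 * j ∧ 2 * j < n := by
      intro j
      rw [Finset.mem_Icc]
      omega
    -- The shift by `1/2` for closed squares makes the argument of the logarithm `n / 2`, as in the
    -- even case.
    have hMn : (M : ℝ) + 1 / 2 = n / 2 := by
      rw [hM]
      push_cast
      ring
    have hsign : (-1 : ℝ) ^ n = -1 := by rw [hM, pow_succ, pow_mul]; norm_num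
    have h := hodd M (by omega)
    convert! hfinal hC₁ (by linarith) (by omega : 1 ≤ M) (by omega) h using 2
    rw [hF hJ, hsign, hMn, hlog2, show 2 / (a - b + c) = 2 * (1 / (a - b + c)) by ring]
    generalize 1 / (a - b + c) = q
    generalize 1 / (a + b + c) = p
    congr 1
    field_simp
    ring
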